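/- Let $\mathcal G_1$ be the figure-8 graph (one vertex, two loops $e_1,e_2$). Replace each edge by its two oriented copies and let $A(e,e')=1$ if the oriented edge $e'$ begins where $e$ ends and $e'\neq\bar e$, and $A(e,e')=0$ otherwise; let $(\Sigma_A^+,\sigma)$ be the associated one-sided subshift of finite type. A weighting $l=(l_1,l_2)\in\mathbb R_{>0}^2$ of the edges has entropy $h(l)=\lim_{T\to\infty}\frac1T\log\#\{\gamma:\ l(\gamma)<T\}$, where $\gamma=(e_0,\dots,e_n=e_0)$, $n\ge1$, runs over the closed cycles of oriented edges without backtracking and $l(\gamma)=\sum_{i<n}l(e_i)$. Put $\mathcal M^1=\{l\in\mathbb R_{>0}^2:\ h(l)=1\}$, and regard functions on the edges as functions on $\Sigma_A^+$ through the zeroth coordinate. For $l\in\mathcal M^1$ let $m_{-l}$ be the equilibrium state of $-l$: $m_{-l}=v\mu/\int v\,d\mu$, where $v>0$ is continuous with $\mathcal L_{-l}v=v$, $\mu$ is a probability measure with $\mathcal L_{-l}^*\mu=\mu$, and $(\mathcal L_fw)(x)=\sum_{\sigma y=x}e^{f(y)}w(y)$. Let $T_l\mathcal M^1=\{\phi:\{e_1,e_2\}\to\mathbb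 R:\ \int\phi\,dm_{-l}=0\}$ and, for $\phi\in T_l\mathcal M^1$, $$\|\phi\|_{WP}^2=\frac{\operatorname{Var}(\phi,m_{-l})}{\int l\,dm_{-l}},\qquad \operatorname{Var}(\phi,m)=\lim_{n\to\infty}\frac1n\int\Big(\sum_{i<n}\phi\circ\sigma^i-n\int\phi\,dm\Big)^2dm .$$ Let $d_{WP}(l,l')$ be the infimum of $\int_0^1\|\dot\gamma(t)\|_{WP}\,dt$ over the continuously differentiable curves $\gamma:[0,1]\to\mathcal M^1$ from $l$ to $l'$. Then: 1. $\mathcal M^1=\{c(x):x>0\}$ with $c(x)=\big(x,\,-\log\frac{1-e^{-x}}{1+3e^{-x}}\big)$. For every $l\in\mathcal M^1$ the equilibrium state $m_{-l}$ exists and is unique, $\int l\,dm_{-l}>0$, and the limit defining $\operatorname{Var}(\phi,m_{-l})$ exists for all $\phi\in T_l\mathcal M^1$. For every $x>0$, $c$ is differentiable at $x$ and $T_{c(x)}\mathcal M^1=\mathbb R\,\dot c(x)$. 2. $d_{WP}$ is a metric on $\mathcal M^1$, and $(\mathcal M^1,d_{WP})$ is complete. 3. $\|\dot c(x)\|_{WP}^2\asymp\frac{-1}{x^2\log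 x}$ as $x\to0^+$ and $\|\dot c(x)\|_{WP}^2\asymp\frac1x$ as $x\to\infty$, where $f\asymp g$ means that $a<f/g<b$ near the limit for some constants $a,b>0$. 4. For every $x_0>0$, $d_{WP}(c(x_0),c(x))\to\infty$ as $x\to0^+$ and as $x\to\infty$. -/

import Mathlib

open Filter Topology MeasureTheory Set

noncomputable section

/-- A finite undirected multigraph (loops allowed) with vertices `V` and edges `Fin k`.
Each edge carries a reference orientation, from `src e` to `tgt e`. -/
structure FinGraph (V : Type) (k : ℕ) where
  src : Fin k → V
  tgt : Fin k → V

/-- Directed edges: `(e, true)` is `e` with its reference orientation, `(e, false)` is `e` with the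
opposite orientation. -/
abbrev DirEdge (k : ℕ) : Type := Fin k × Bool

/-- The same edge with the opposite orientation. -/
def DirEdge.bar {k : ℕ} (e : DirEdge k) : DirEdge k := (e.1, !e.2)

namespace FinGraph

variable {V : Type} {k : ℕ}

def origin (G : FinGraph V k) (e : DirEdge k) : V := if e.2 then G.src e.1 else G.tgt e.1

def terminus (G : FinGraph V k) (e : DirEdge k) : V := if e.2 then G.tgt e.1 else G.src e.1

/-- `A(e, e') = 1`: the directed edge `e'` follows `e` without backtracking. -/
def Adj (G : FinGraph V k) (e e' : DirEdge k) : Prop :=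
  G.origin e' = G.terminus e ∧ e' ≠ e.bar

/-- A closed cycle `(e_0, e_1, …, e_n = e_0)`, `n ≥ 1`, of directed edges without backtracking. -/
structure ClosedCycle (G : FinGraph V k) where
  n : ℕ
  pos : 0 < n
  edge : Fin (n + 1) → DirEdge k
  closed : edge (Fin.last n) = edge 0
  step : ∀ i : Fin n, G.Adj (edge i.castSucc) (edge i.succ)

/-- The length `l(e_0) + ⋯ + l(e_{n-1})` of a closed cycle. -/
def ClosedCycle.length {G : FinGraph V k} (γ : G.ClosedCycle) (l : Fin k → ℝ) : ℝ :=
  ∑ i : Fin γ.n, l (γ.edge i.castSucc).1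

/-- The limit `lim_{T → ∞} (1/T) log #{γ : l(γ) < T}` exists and equals `h`. -/
def HasEntropy (G : FinGraph V k) (l : Fin k → ℝ) (h : ℝ) : Prop :=
  Tendsto (fun T : ℝ => 1 / T * Real.log (({γ : G.ClosedCycle | γ.length l < T}.ncard : ℕ) : ℝ))
    atTop (𝓝 h)

/-- The moduli space of positive edge weightings with entropy one. -/
def entropyOne (G : FinGraph V k) : Set (Fin k → ℝ) :=
  {l | (∀ e, 0 < l e) ∧ G.HasEntropy l 1}

/-- The moduli space as a bare type (no topology or distance is inherited from `ℝ^k`). -/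
def EntropyOneSpace (G : FinGraph V k) : Type := {l : Fin k → ℝ // l ∈ G.entropyOne}

/-- The one-sided subshift of finite type of the graph. -/
abbrev Shift (G : FinGraph V k) : Type :=
  {x : ℕ → DirEdge k // ∀ n, G.Adj (x n) (x (n + 1))}

/-- The shift map. -/
def shift (G : FinGraph V k) (x : G.Shift) : G.Shift :=
  ⟨fun n => x.1 (n + 1), fun n => x.2 (n + 1)⟩

/-- An edge weighting as a locally constant function on the shift space. -/
def onShift (G : FinGraph V k) (φ : Fin k → ℝ) (x : G.Shift) : ℝ := φ (x.1 0).1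

/-- The transfer operator `(L_f w)(x) = ∑_{σ y = x} e^{f(y)} w(y)`; the sum is finite. -/
def transfer (G : FinGraph V k) (f w : G.Shift → ℝ) (x : G.Shift) : ℝ :=
  ∑ᶠ (y : G.Shift) (_ : G.shift y = x), Real.exp (f y) * w y

/-- `m` is the equilibrium state of the pressure-zero function `f`: the transfer operator has a
strictly positive continuous eigenfunction `v` for the eigenvalue `1` (which is therefore its maximal
eigenvalue, that is, the pressure of `f` is `log 1 = 0`), its dual fixes the probability measure `μ`,
and `m = v μ / ∫ v dμ`. -/
def IsEquilibriumState (G : FinGraph V k) (f : G.Shift → ℝ) (m : Measure G.Shift) : Prop :=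
  ∃ (v : C(G.Shift, ℝ)) (μ : Measure G.Shift),
    (∀ x, 0 < v x) ∧
    (∀ x, G.transfer f v x = v x) ∧
    IsProbabilityMeasure μ ∧
    (∀ φ : C(G.Shift, ℝ), ∫ x, G.transfer f φ x ∂μ = ∫ x, φ x ∂μ) ∧
    m = μ.withDensity (fun x => ENNReal.ofReal (v x / ∫ y, v y ∂μ))

/-- The equilibrium state `m_{-l}`. -/
def eqState (G : FinGraph V k) (l : Fin k → ℝ) : Measure G.Shift :=
  Classical.epsilon (G.IsEquilibriumState (fun x => -G.onShift l x))

/-- The `n`-th term `(1/n) ∫ (w^n - n ∫ w dm)² dm` of the sequence defining the variance. -/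
def varSeq (G : FinGraph V k) (w : G.Shift → ℝ) (m : Measure G.Shift) (n : ℕ) : ℝ :=
  1 / (n : ℝ) * ∫ x, (birkhoffSum G.shift w n x - n * ∫ y, w y ∂m) ^ 2 ∂m

/-- The (asymptotic) variance `Var(w, m)`. -/
def asympVar (G : FinGraph V k) (w : G.Shift → ℝ) (m : Measure G.Shift) : ℝ :=
  limUnder atTop (G.varSeq w m)

/-- The tangent space of the moduli space at `l`: the `φ` with `∫ φ dm_{-l} = 0`. -/
def tangentSpace (G : FinGraph V k) (l : Fin k → ℝ) : Set (Fin k → ℝ) :=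
  {φ | ∫ x, G.onShift φ x ∂(G.eqState l) = 0}

/-- `‖φ‖_WP² = Var(φ, m_{-l}) / ∫ l dm_{-l}` for a tangent vector `φ` at `l`. -/
def wpNormSq (G : FinGraph V k) (l φ : Fin k → ℝ) : ℝ :=
  G.asympVar (G.onShift φ) (G.eqState l) / ∫ x, G.onShift l x ∂(G.eqState l)

def wpNorm (G : FinGraph V k) (l φ : Fin k → ℝ) : ℝ := √(G.wpNormSq l φ)

/-- `γ` restricts to a continuously differentiable curve `[0, 1] → entropyOne` from `l₁` to `l₂`. -/
def IsCurve (G : FinGraph V k) (l₁ l₂ : Fin k → ℝ) (γ : ℝ → Fin k → ℝ) : Prop :=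
  ContDiffOn ℝ 1 γ (Icc 0 1) ∧ (∀ t ∈ Icc (0 : ℝ) 1, γ t ∈ G.entropyOne) ∧ γ 0 = l₁ ∧ γ 1 = l₂

/-- The Weil-Petersson length of a curve. -/
def wpLength (G : FinGraph V k) (γ : ℝ → Fin k → ℝ) : ENNReal :=
  ∫⁻ t in Icc (0 : ℝ) 1, ENNReal.ofReal (G.wpNorm (γ t) (derivWithin γ (Icc 0 1) t))

/-- The Weil-Petersson path distance. -/
def wpDist (G : FinGraph V k) (l₁ l₂ : Fin k → ℝ) : ENNReal :=
  ⨅ (γ : ℝ → Fin k → ℝ) (_ : G.IsCurve l₁ l₂ γ), G.wpLength γ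

end FinGraph

/-- The figure-8 graph: one vertex and two loops. -/
def figureEight : FinGraph Unit 2 where
  src := fun _ => ()
  tgt := fun _ => ()

/-- The curve `c(x) = (x, -log ((1 - e^{-x}) / (1 + 3 e^{-x})))`. -/
def figureEightCurve (x : ℝ) : Fin 2 → ℝ :=
  ![x, -Real.log ((1 - Real.exp (-x)) / (1 + 3 * Real.exp (-x)))]

/-- `f ≍ g` along the filter `F`. -/
def Comparable (F : Filter ℝ) (f g : ℝ → ℝ) : Prop :=
  ∃ c c' : ℝ, 0 < c ∧ 0 < c' ∧ ∀ᶠ x in F, c < f x / g x ∧ f x / g x < c'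

end

/-
The transfer operator of a weighting acts on functions of the initial edge by a finite matrix, and
for the figure-8 graph it has the eigenvalue `1` with a positive eigenvector exactly when
`X = e^{-l 0}` and `Y = e^{-l 1}` satisfy `1 - X - Y - 3 X Y = 0`. This is the equation of the
entropy-one locus, which is therefore a curve, and the eigenvector gives the equilibrium state.
Mean-zero functions of the edge are eigenvectors of the normalized operator for the eigenvalue
`X + Y - 1`, so correlations decay geometrically and the variance is a geometric sum. Since the
moduli space is a curve, its path distance is the difference of an arc length parameter; the
asymptotics of the speed show that this parameter is unbounded at both ends, so it is an isometry
onto `ℝ`.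
-/

noncomputable section

section FixedMeasure

variable {X : Type*} [TopologicalSpace X] {L : C(X, ℝ) →ₗ[ℝ] C(X, ℝ)} {w : C(X, ℝ)}

/-- The average of the first `n` iterates of `L`, evaluated at the point `x`. -/
def evalAverage (L : C(X, ℝ) →ₗ[ℝ] C(X, ℝ)) (x : X) (n : ℕ) : C(X, ℝ) →ₗ[ℝ] ℝ where
  toFun := birkhoffAverage ℝ L (fun φ => φ x) n
  map_add' φ ψ := by
    simp [birkhoffAverage, birkhoffSum, iterate_map_add, Finset.sum_add_distrib, mul_add]
  map_smul' c φ := by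
    have (i : ℕ) : L^[i] (c • φ) = c • L^[i] φ := by
      rw [← Module.End.pow_apply, map_smul, Module.End.pow_apply]
    simp [birkhoffAverage, birkhoffSum, this, ← Finset.mul_sum, mul_left_comm]

theorem evalAverage_apply (x : X) (n : ℕ) (φ : C(X, ℝ)) :
    evalAverage L x n φ = (n : ℝ)⁻¹ * ∑ i ∈ Finset.range n, (L^[i] φ) x := rfl

theorem abs_iterate_apply_le (hL : ∀ φ, 0 ≤ φ → 0 ≤ L φ) (hw : L w = w) {φ : C(X, ℝ)} {C : ℝ}
    (hφ : ∀ x, |φ x| ≤ C * w x) (n : ℕ) (x : X) : |(L^[n] φ) x| ≤ C * w x := by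
  induction n generalizing φ with
  | zero => exact hφ x
  | succ _ ih =>
    refine ih fun y => abs_le.2 ⟨neg_le_iff_add_nonneg.2 ?_, sub_nonneg.1 ?_⟩
    · have := hL (φ + C • w) fun z => neg_le_iff_add_nonneg.1 (neg_le_of_abs_le (hφ z))
      rw [map_add, map_smul, hw] at this
      exact this y
    · have := hL (C • w - φ) fun z => sub_nonneg.2 (le_of_abs_le (hφ z))
      rw [map_sub, map_smul, hw] at this
      exact this y

theorem abs_evalAverage_le {x : X} {φ : C(X, ℝ)} {C : ℝ} (hC : ∀ n, |(L^[n] φ) x| ≤ C) (n : ℕ) :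
    |evalAverage L x n φ| ≤ C := by
  rcases n.eq_zero_or_pos with rfl | hn
  · simpa [evalAverage_apply] using (abs_nonneg _).trans (hC 0)
  · rw [evalAverage_apply, abs_mul, abs_inv, Nat.abs_cast,
      inv_mul_le_iff₀ (Nat.cast_pos.2 hn)]
    calc |∑ i ∈ Finset.range n, (L^[i] φ) x| ≤ ∑ i ∈ Finset.range n, |(L^[i] φ) x| :=
          Finset.abs_sum_le_sum_abs _ _
      _ ≤ ∑ _i ∈ Finset.range n, C := Finset.sum_le_sum fun i _ => hC i
      _ = n * C := by simp

theorem exists_tendsto_evalAverage {x : X} {φ : C(X, ℝ)} {C : ℝ} (hC : ∀ n, |(L^[n] φ) x| ≤ C)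
    (𝒰 : Ultrafilter ℕ) : ∃ a, Tendsto (fun n => evalAverage L x n φ) 𝒰 (𝓝 a) := by
  have hmem : ∀ᶠ n in (𝒰 : Filter ℕ), evalAverage L x n φ ∈ Metric.closedBall (0 : ℝ) C :=
    Eventually.of_forall fun n => mem_closedBall_zero_iff.2 (abs_evalAverage_le hC n)
  obtain ⟨a, -, ha⟩ := (isCompact_closedBall (0 : ℝ) C).ultrafilter_le_nhds
    (𝒰.map fun n => evalAverage L x n φ) (tendsto_principal.2 hmem)
  exact ⟨a, ha⟩

theorem tendsto_evalAverage_map_sub {x : X} {φ : C(X, ℝ)} {C : ℝ}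
    (hC : ∀ n, |(L^[n] φ) x| ≤ C) :
    Tendsto (fun n => evalAverage L x n (L φ) - evalAverage L x n φ) atTop (𝓝 0) :=
  tendsto_birkhoffAverage_apply_sub_birkhoffAverage ℝ (g := fun ψ : C(X, ℝ) => ψ x)
    (isBounded_iff_forall_norm_le.2 ⟨C, by rintro _ ⟨n, rfl⟩; exact hC n⟩)

variable [CompactSpace X]

theorem exists_forall_abs_le_mul (hw : ∀ x, 0 < w x) (φ : C(X, ℝ)) :
    ∃ C, ∀ x, |φ x| ≤ C * w x := by
  have hcont : Continuous fun x => φ x / w x :=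
    φ.continuous.div w.continuous fun x => (hw x).ne'
  obtain ⟨C, hC⟩ := isCompact_univ.exists_bound_of_continuousOn hcont.continuousOn
  refine ⟨C, fun x => ?_⟩
  have := hC x (mem_univ x)
  rwa [norm_div, Real.norm_eq_abs, Real.norm_of_nonneg (hw x).le, div_le_iff₀ (hw x)] at this

theorem exists_nonneg_functional_map_eq (hL : ∀ φ, 0 ≤ φ → 0 ≤ L φ) (hpos : ∀ x, 0 < w x)
    (hw : L w = w) (x : X) :
    ∃ Λ : C(X, ℝ) →ₗ[ℝ] ℝ, (∀ φ, 0 ≤ φ → 0 ≤ Λ φ) ∧ (∀ φ, Λ (L φ) = Λ φ) ∧ Λ w = w x := by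
  have hbdd (φ : C(X, ℝ)) : ∃ C, ∀ n, |(L^[n] φ) x| ≤ C := by
    obtain ⟨C, hC⟩ := exists_forall_abs_le_mul hpos φ
    exact ⟨C * w x, fun n => abs_iterate_apply_le hL hw hC n x⟩
  let 𝒰 : Ultrafilter ℕ := hyperfilter ℕ
  have h𝒰 : (𝒰 : Filter ℕ) ≤ atTop := Nat.hyperfilter_le_atTop
  choose Λ hΛ using fun φ => exists_tendsto_evalAverage (hbdd φ).choose_spec 𝒰
  refine ⟨linearMapOfTendsto Λ (evalAverage L x) (tendsto_pi_nhds.2 hΛ), fun φ hφ => ?_,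
    fun φ => ?_, ?_⟩
  · refine ge_of_tendsto' (hΛ φ) fun n => ?_
    have hiter (i : ℕ) : 0 ≤ L^[i] φ := Function.Iterate.rec (0 ≤ ·) hφ (fun ψ => hL ψ) i
    exact mul_nonneg (by positivity) (Finset.sum_nonneg fun i _ => hiter i x)
  · exact sub_eq_zero.1 (tendsto_nhds_unique ((hΛ (L φ)).sub (hΛ φ))
      ((tendsto_evalAverage_map_sub (hbdd φ).choose_spec).mono_left h𝒰))
  · refine tendsto_nhds_unique (hΛ w) (tendsto_const_nhds.congr' ?_)
    filter_upwards [h𝒰 (eventually_ne_atTop 0)] with n hn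
    simp [evalAverage_apply, Function.iterate_fixed hw, hn]

variable [T2Space X] [MeasurableSpace X] [BorelSpace X]

theorem exists_isFiniteMeasure_integral_eq {Λ : C(X, ℝ) →ₗ[ℝ] ℝ} (hΛ : ∀ φ, 0 ≤ φ → 0 ≤ Λ φ) :
    ∃ μ : Measure X, IsFiniteMeasure μ ∧ ∀ φ : C(X, ℝ), ∫ x, φ x ∂μ = Λ φ := by
  let Λ' : CompactlySupportedContinuousMap X ℝ →ₗ[ℝ] ℝ :=
    { toFun φ := Λ φ.toContinuousMap
      map_add' φ ψ := Λ.map_add φ.toContinuousMap ψ.toContinuousMap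
      map_smul' c φ := Λ.map_smul c φ.toContinuousMap }
  let Λ₀ := PositiveLinearMap.mk₀ Λ' fun φ hφ => hΛ φ.toContinuousMap hφ
  exact ⟨RealRMK.rieszMeasure Λ₀, inferInstance, fun φ => RealRMK.integral_rieszMeasure Λ₀
    (CompactlySupportedContinuousMap.continuousMapEquiv φ)⟩

theorem exists_isProbabilityMeasure_integral_map_eq [Nonempty X] (hL : ∀ φ, 0 ≤ φ → 0 ≤ L φ)
    (hpos : ∀ x, 0 < w x) (hw : L w = w) :
    ∃ μ : Measure X, IsProbabilityMeasure μ ∧ ∀ φ : C(X, ℝ), ∫ x, L φ x ∂μ = ∫ x, φ x ∂μ := by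
  obtain ⟨x⟩ := ‹Nonempty X›
  obtain ⟨Λ, hΛ, hfix, hΛw⟩ := exists_nonneg_functional_map_eq hL hpos hw x
  obtain ⟨μ, hμ, hint⟩ := exists_isFiniteMeasure_integral_eq hΛ
  have : NeZero μ := ⟨by
    rintro rfl
    have := hint w
    rw [hΛw, integral_zero_measure] at this
    exact (hpos x).ne this⟩
  refine ⟨(μ univ)⁻¹ • μ, isProbabilityMeasureSMul, fun φ => ?_⟩
  rw [integral_smul_measure, integral_smul_measure, hint, hint, hfix]

end FixedMeasure

section GeometricCorrelations

variable {X : Type*} [TopologicalSpace X] {T : X → X} {f : X → ℝ} {r : ℝ}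

theorem continuous_birkhoffSum (hT : Continuous T) (hf : Continuous f) (n : ℕ) :
    Continuous (birkhoffSum T f n) :=
  continuous_finsetSum _ fun i _ => hf.comp (hT.iterate i)

variable [MeasurableSpace X] {m : Measure X}

theorem integrable_of_continuous [CompactSpace X] [OpensMeasurableSpace X] [IsFiniteMeasure m]
    (hf : Continuous f) : Integrable f m :=
  hf.integrable_of_hasCompactSupport (HasCompactSupport.of_compactSpace f)

/-- Composing with `T` multiplies the correlations of continuous functions with `f` by `r`. -/
def HasGeometricCorrelations (T : X → X) (m : Measure X) (f : X → ℝ) (r : ℝ) : Prop :=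
  ∀ u : X → ℝ, Continuous u → ∫ x, f x * u (T x) ∂m = r * ∫ x, f x * u x ∂m

namespace HasGeometricCorrelations

theorem integral_eq_zero (h : HasGeometricCorrelations T m f r) (hr : r ≠ 1) :
    ∫ x, f x ∂m = 0 := by
  have hone := h (fun _ => 1) continuous_const
  simp only [mul_one] at hone
  have hprod : (1 - r) * ∫ x, f x ∂m = 0 := by linarith
  exact (mul_eq_zero.1 hprod).resolve_left (sub_ne_zero.2 hr.symm)

variable [CompactSpace X] [OpensMeasurableSpace X] [IsFiniteMeasure m]

theorem integral_mul_birkhoffSum (h : HasGeometricCorrelations T m f r) (hT : Continuous T)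
    (hf : Continuous f) (n : ℕ) :
    ∫ x, f x * birkhoffSum T f n x ∂m = (∑ i ∈ Finset.range n, r ^ i) * ∫ x, f x ^ 2 ∂m := by
  induction n with
  | zero => simp
  | succ n ih =>
    have hS := continuous_birkhoffSum hT hf n
    have hsq : Continuous fun x => f x ^ 2 := hf.pow 2
    have hcross : Continuous fun x => f x * birkhoffSum T f n (T x) := hf.mul (hS.comp hT)
    calc ∫ x, f x * birkhoffSum T f (n + 1) x ∂m
        = ∫ x, (f x ^ 2 + f x * birkhoffSum T f n (T x)) ∂m := by
          simp only [birkhoffSum_succ', mul_add, sq]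
      _ = ∫ x, f x ^ 2 ∂m + r * ∫ x, f x * birkhoffSum T f n x ∂m := by
          rw [integral_add (integrable_of_continuous hsq) (integrable_of_continuous hcross),
            h _ hS]
      _ = (∑ i ∈ Finset.range (n + 1), r ^ i) * ∫ x, f x ^ 2 ∂m := by
          rw [ih, geom_sum_succ]
          ring

theorem integral_birkhoffSum_sq_succ (h : HasGeometricCorrelations T m f r) (hT : Continuous T)
    (hf : Continuous f) (hinv : ∀ u : X → ℝ, Continuous u → ∫ x, u (T x) ∂m = ∫ x, u x ∂m)
    (n : ℕ) :
    ∫ x, birkhoffSum T f (n + 1) x ^ 2 ∂m = ∫ x, birkhoffSum T f n x ^ 2 ∂m +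
      (1 + 2 * r * ∑ i ∈ Finset.range n, r ^ i) * ∫ x, f x ^ 2 ∂m := by
  have hS := continuous_birkhoffSum hT hf n
  have hS₂ : Continuous fun x => birkhoffSum T f n (T x) ^ 2 := (hS.comp hT).pow 2
  have hf₂ : Continuous fun x => f x ^ 2 := hf.pow 2
  have hcross : Continuous fun x => 2 * (f x * birkhoffSum T f n (T x)) :=
    (hf.mul (hS.comp hT)).const_mul 2
  have hrest : Continuous fun x => f x ^ 2 + 2 * (f x * birkhoffSum T f n (T x)) :=
    hf₂.add hcross
  have hexpand (x : X) : birkhoffSum T f (n + 1) x ^ 2 =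
      birkhoffSum T f n (T x) ^ 2 + (f x ^ 2 + 2 * (f x * birkhoffSum T f n (T x))) := by
    rw [birkhoffSum_succ']; ring
  simp only [hexpand]
  rw [integral_add (integrable_of_continuous hS₂) (integrable_of_continuous hrest),
    integral_add (integrable_of_continuous hf₂) (integrable_of_continuous hcross),
    integral_const_mul, h _ hS, h.integral_mul_birkhoffSum hT hf,
    hinv (fun x => birkhoffSum T f n x ^ 2) (hS.pow 2)]
  ring

theorem tendsto_integral_birkhoffSum_sq (h : HasGeometricCorrelations T m f r)
    (hT : Continuous T) (hf : Continuous f)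
    (hinv : ∀ u : X → ℝ, Continuous u → ∫ x, u (T x) ∂m = ∫ x, u x ∂m) (hr : |r| < 1) :
    Tendsto (fun n : ℕ => (n : ℝ)⁻¹ * ∫ x, birkhoffSum T f n x ^ 2 ∂m) atTop
      (𝓝 ((1 + r) / (1 - r) * ∫ x, f x ^ 2 ∂m)) := by
  have hsum (n : ℕ) : ∫ x, birkhoffSum T f n x ^ 2 ∂m = ∑ i ∈ Finset.range n,
      (1 + 2 * r * ∑ j ∈ Finset.range i, r ^ j) * ∫ x, f x ^ 2 ∂m := by
    induction n with
    | zero => simp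
    | succ n ih => rw [h.integral_birkhoffSum_sq_succ hT hf hinv, ih, Finset.sum_range_succ]
  have hgeom : Tendsto (fun n => ∑ j ∈ Finset.range n, r ^ j) atTop (𝓝 (1 - r)⁻¹) :=
    (hasSum_geometric_of_abs_lt_one hr).tendsto_sum_nat
  have hlimit : (1 + r) / (1 - r) = 1 + 2 * r * (1 - r)⁻¹ := by
    have : 1 - r ≠ 0 := by linarith [(abs_lt.1 hr).2]
    field_simp
    ring
  simp only [hsum, hlimit]
  exact (((hgeom.const_mul _).const_add 1).mul_const _).cesaro

end HasGeometricCorrelations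

end GeometricCorrelations

section NormalizedDensity

variable {X : Type*} [TopologicalSpace X] [MeasurableSpace X]
  [OpensMeasurableSpace X] {μ : Measure X} {v : X → ℝ}

theorem integral_withDensity_div_integral (hv : Continuous v) (hpos : ∀ x, 0 < v x)
    (g : X → ℝ) :
    ∫ x, g x ∂(μ.withDensity fun x => ENNReal.ofReal (v x / ∫ y, v y ∂μ)) =
      (∫ x, v x * g x ∂μ) / ∫ x, v x ∂μ := by
  rw [integral_withDensity_eq_integral_toReal_smul ((hv.measurable.div_const _).ennreal_ofReal)
    (ae_of_all _ fun x => ENNReal.ofReal_lt_top), ← integral_div]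
  congr 1 with x
  rw [ENNReal.toReal_ofReal (div_nonneg (hpos x).le (integral_nonneg fun y => (hpos y).le)),
    smul_eq_mul, div_mul_eq_mul_div]

variable [CompactSpace X]

theorem integral_pos_of_continuous_of_pos [IsProbabilityMeasure μ] (hv : Continuous v)
    (hpos : ∀ x, 0 < v x) : 0 < ∫ x, v x ∂μ := by
  rw [integral_pos_iff_support_of_nonneg (fun x => (hpos x).le) (integrable_of_continuous hv),
    Function.support_eq_univ fun x => (hpos x).ne']
  simp

theorem isProbabilityMeasure_withDensity_div_integral [IsProbabilityMeasure μ]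
    (hv : Continuous v) (hpos : ∀ x, 0 < v x) :
    IsProbabilityMeasure (μ.withDensity fun x => ENNReal.ofReal (v x / ∫ y, v y ∂μ)) := by
  have hZ : 0 < ∫ x, v x ∂μ := integral_pos_of_continuous_of_pos hv hpos
  constructor
  rw [withDensity_apply _ MeasurableSet.univ, Measure.restrict_univ,
    ← ofReal_integral_eq_lintegral_ofReal (integrable_of_continuous (hv.div_const _))
      (ae_of_all _ fun x => div_nonneg (hpos x).le hZ.le),
    integral_div, div_self hZ.ne', ENNReal.ofReal_one]

end NormalizedDensity

theorem DirEdge.bar_bar {k : ℕ} (e : DirEdge k) : e.bar.bar = e := by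
  simp [DirEdge.bar]

namespace FinGraph

variable {V : Type} {k : ℕ} {G : FinGraph V k}

theorem origin_bar (e : DirEdge k) : G.origin e.bar = G.terminus e := by
  cases h : e.2 <;> simp [origin, terminus, DirEdge.bar, h]

theorem terminus_bar (e : DirEdge k) : G.terminus e.bar = G.origin e := by
  cases h : e.2 <;> simp [origin, terminus, DirEdge.bar, h]

theorem adj_bar_bar {e e' : DirEdge k} : G.Adj e'.bar e.bar ↔ G.Adj e e' := by
  rw [Adj, Adj, origin_bar, terminus_bar, DirEdge.bar_bar, eq_comm, ne_comm]

/-- Any two directed edges are joined by a path without backtracking. -/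
def IsIrreducible (G : FinGraph V k) : Prop :=
  ∀ e e', Relation.ReflTransGen G.Adj e e'

section Prepend

open Classical in
/-- Prepend the directed edge `e` to the path `x`; the junk value is `x` itself if the resulting
path is not admissible. -/
def prepend (G : FinGraph V k) (e : DirEdge k) (x : G.Shift) : G.Shift :=
  if h : G.Adj e (x.1 0) then
    ⟨fun n => Nat.casesOn n e x.1, fun n => by cases n with
      | zero => exact h
      | succ n => exact x.2 n⟩
  else x

variable {e : DirEdge k} {x : G.Shift}

theorem prepend_zero (h : G.Adj e (x.1 0)) : (G.prepend e x).1 0 = e := by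
  simp [prepend, h]

theorem prepend_succ (h : G.Adj e (x.1 0)) (n : ℕ) : (G.prepend e x).1 (n + 1) = x.1 n := by
  simp [prepend, h]

theorem shift_prepend (h : G.Adj e (x.1 0)) : G.shift (G.prepend e x) = x :=
  Subtype.ext (funext (prepend_succ h))

theorem prepend_shift (y : G.Shift) : G.prepend (y.1 0) (G.shift y) = y := by
  have h : G.Adj (y.1 0) ((G.shift y).1 0) := y.2 0
  refine Subtype.ext (funext fun n => ?_)
  cases n with
  | zero => exact prepend_zero h
  | succ n => exact prepend_succ h n

theorem exists_path_from (h : ∀ e, ∃ e', G.Adj e e') (e : DirEdge k) :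
    ∃ x : G.Shift, x.1 0 = e := by
  choose next hnext using h
  refine ⟨⟨fun n => next^[n] e, fun n => ?_⟩, rfl⟩
  simpa only [Function.iterate_succ_apply'] using hnext (next^[n] e)

end Prepend

section ShiftTopology

theorem continuous_coord (n : ℕ) : Continuous (fun x : G.Shift => x.1 n) :=
  (continuous_apply n).comp continuous_subtype_val

theorem continuous_shift : Continuous G.shift :=
  Continuous.subtype_mk (continuous_pi fun n => continuous_coord (n + 1)) _

theorem continuous_edgeFun (g : DirEdge k → ℝ) : Continuous fun x : G.Shift => g (x.1 0) :=
  continuous_of_discreteTopology.comp (continuous_coord 0)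

theorem continuous_onShift (φ : Fin k → ℝ) : Continuous (G.onShift φ) :=
  continuous_edgeFun fun e => φ e.1

theorem isClopen_setOf_coord (n : ℕ) (p : DirEdge k → Prop) :
    IsClopen {x : G.Shift | p (x.1 n)} :=
  (isClopen_discrete {e | p e}).preimage (continuous_coord n)

theorem continuous_prepend (e : DirEdge k) : Continuous (G.prepend e) := by
  classical
  refine Continuous.subtype_mk (f := fun x => (G.prepend e x).1) (continuous_pi fun n => ?_) _
  have hcoord (x : G.Shift) : (G.prepend e x).1 n =
      if G.Adj e (x.1 0) then Nat.casesOn n e x.1 else x.1 n := by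
    unfold prepend
    split_ifs <;> rfl
  simp only [hcoord]
  refine Continuous.if (by simp [(isClopen_setOf_coord 0 (G.Adj e)).frontier_eq]) ?_
    (continuous_coord n)
  cases n with
  | zero => exact continuous_const
  | succ n => exact continuous_coord n

instance compactSpace_shift : CompactSpace G.Shift := by
  have hclosed : IsClosed {x : ℕ → DirEdge k | ∀ n, G.Adj (x n) (x (n + 1))} := by
    rw [ofPred_forall]
    refine isClosed_iInter fun n => ?_
    have hpair : Continuous fun x : ℕ → DirEdge k => (x n, x (n + 1)) := by fun_prop
    exact (isClosed_discrete {p : DirEdge k × DirEdge k | G.Adj p.1 p.2}).preimage hpair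
  exact isCompact_iff_compactSpace.1 hclosed.isCompact

theorem exists_mem_zero_eq_of_prepend_mem (hG : G.IsIrreducible) {S : Set G.Shift}
    (hne : S.Nonempty) (hS : ∀ x ∈ S, ∀ e, G.Adj e (x.1 0) → G.prepend e x ∈ S)
    (e : DirEdge k) : ∃ y ∈ S, y.1 0 = e := by
  obtain ⟨x, hx⟩ := hne
  induction hG e (x.1 0) using Relation.ReflTransGen.head_induction_on with
  | refl => exact ⟨x, hx, rfl⟩
  | head hadj _ ih =>
    obtain ⟨y, hy, rfl⟩ := ih
    exact ⟨_, hS y hy _ hadj, prepend_zero hadj⟩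

theorem dense_of_prepend_mem (hG : G.IsIrreducible) {S : Set G.Shift} (hne : S.Nonempty)
    (hS : ∀ x ∈ S, ∀ e, G.Adj e (x.1 0) → G.prepend e x ∈ S) : Dense S := by
  have happrox (n : ℕ) (z : G.Shift) : ∃ y ∈ S, ∀ i ≤ n, y.1 i = z.1 i := by
    induction n generalizing z with
    | zero => simpa using exists_mem_zero_eq_of_prepend_mem hG hne hS (z.1 0)
    | succ n ih =>
      obtain ⟨y, hy, hyz⟩ := ih (G.shift z)
      have hadj : G.Adj (z.1 0) (y.1 0) := by
        rw [hyz 0 n.zero_le]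
        exact z.2 0
      refine ⟨_, hS y hy _ hadj, fun i hi => ?_⟩
      cases i with
      | zero => exact prepend_zero hadj
      | succ i => exact (prepend_succ hadj i).trans (hyz i (by omega))
  intro z
  choose y hy hyz using fun n => happrox n z
  refine mem_closure_of_tendsto (f := y) (b := atTop) ?_ (Eventually.of_forall hy)
  rw [tendsto_subtype_rng, tendsto_pi_nhds]
  intro i
  refine tendsto_const_nhds.congr' ?_
  filter_upwards [eventually_ge_atTop i] with n hn
  exact (hyz n i hn).symm

end ShiftTopology

section Transfer

variable {f : G.Shift → ℝ}

open Classical in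
theorem transfer_eq_sum (f w : G.Shift → ℝ) (x : G.Shift) :
    G.transfer f w x =
      ∑ e with G.Adj e (x.1 0), Real.exp (f (G.prepend e x)) * w (G.prepend e x) := by
  have hpre : {y : G.Shift | G.shift y = x} = (G.prepend · x) '' {e | G.Adj e (x.1 0)} := by
    ext y
    constructor
    · rintro rfl
      exact ⟨y.1 0, y.2 0, prepend_shift y⟩
    · rintro ⟨e, he, rfl⟩
      exact shift_prepend he
  have hinj : InjOn (G.prepend · x) {e | G.Adj e (x.1 0)} := fun e he e' he' h => by
    rw [← prepend_zero he, ← prepend_zero he']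
    exact congrArg (fun z : G.Shift => z.1 0) h
  change ∑ᶠ y ∈ {y : G.Shift | G.shift y = x}, Real.exp (f y) * w y = _
  rw [hpre, finsum_mem_image hinj, ← finsum_mem_coe_finset]
  simp

theorem transfer_add (f v w : G.Shift → ℝ) (x : G.Shift) :
    G.transfer f (fun y => v y + w y) x = G.transfer f v x + G.transfer f w x := by
  classical
  simp only [transfer_eq_sum, mul_add, Finset.sum_add_distrib]

theorem transfer_const_mul (f w : G.Shift → ℝ) (c : ℝ) (x : G.Shift) :
    G.transfer f (fun y => c * w y) x = c * G.transfer f w x := by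
  classical
  simp only [transfer_eq_sum, Finset.mul_sum, mul_left_comm]

theorem transfer_nonneg (f : G.Shift → ℝ) {w : G.Shift → ℝ} (hw : ∀ x, 0 ≤ w x) (x : G.Shift) :
    0 ≤ G.transfer f w x := by
  classical
  rw [transfer_eq_sum]
  exact Finset.sum_nonneg fun e _ => mul_nonneg (Real.exp_pos _).le (hw _)

theorem transfer_mul_comp_shift (f w u : G.Shift → ℝ) (x : G.Shift) :
    G.transfer f (fun y => w y * u (G.shift y)) x = G.transfer f w x * u x := by
  classical
  simp only [transfer_eq_sum, Finset.sum_mul]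
  refine Finset.sum_congr rfl fun e he => ?_
  rw [shift_prepend (Finset.mem_filter.1 he).2, mul_assoc]

theorem continuous_transfer (hf : Continuous f) {w : G.Shift → ℝ} (hw : Continuous w) :
    Continuous (G.transfer f w) := by
  classical
  simp only [funext (transfer_eq_sum f w), Finset.sum_filter]
  refine continuous_finsetSum _ fun e _ => Continuous.if
    (by simp [(isClopen_setOf_coord 0 (G.Adj e)).frontier_eq]) ?_ continuous_const
  exact (Real.continuous_exp.comp (hf.comp (continuous_prepend e))).mul
    (hw.comp (continuous_prepend e))

/-- The transfer operator of a continuous potential on continuous functions. -/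
def transferMap (hf : Continuous f) : C(G.Shift, ℝ) →ₗ[ℝ] C(G.Shift, ℝ) where
  toFun w := ⟨G.transfer f w, continuous_transfer hf w.continuous⟩
  map_add' v w := ContinuousMap.ext (transfer_add f v w)
  map_smul' c w := ContinuousMap.ext (transfer_const_mul f w c)

theorem eq_zero_prepend_of_transfer_eq_self {u : G.Shift → ℝ} (hu : ∀ x, 0 ≤ u x)
    (hfix : ∀ x, G.transfer f u x = u x) {x : G.Shift} (hx : u x = 0) {e : DirEdge k}
    (he : G.Adj e (x.1 0)) : u (G.prepend e x) = 0 := by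
  classical
  have hsum := (transfer_eq_sum f u x).symm.trans ((hfix x).trans hx)
  rw [Finset.sum_eq_zero_iff_of_nonneg fun d _ => mul_nonneg (Real.exp_pos _).le (hu _)] at hsum
  exact (mul_eq_zero.1 (hsum e (by simp [he]))).resolve_left (Real.exp_pos _).ne'

/-- Subtracting the largest multiple of `w` below `v` leaves a nonnegative fixed function with a
zero, and the zeros of such a function are closed under `prepend`, hence dense. -/
theorem exists_eq_const_mul_of_transfer_eq_self (hG : G.IsIrreducible) {v w : G.Shift → ℝ}
    (hv : Continuous v) (hw : Continuous w) (hpos : ∀ x, 0 < w x)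
    (hvfix : ∀ x, G.transfer f v x = v x) (hwfix : ∀ x, G.transfer f w x = w x) :
    ∃ c, ∀ x, v x = c * w x := by
  rcases isEmpty_or_nonempty G.Shift with hempty | ⟨⟨y⟩⟩
  · exact ⟨0, hempty.elim⟩
  obtain ⟨x₀, -, hmin⟩ := isCompact_univ.exists_isMinOn ⟨y, mem_univ y⟩
    (hv.div hw fun x => (hpos x).ne').continuousOn
  set c := v x₀ / w x₀ with hc
  have hu (x : G.Shift) : 0 ≤ v x + -c * w x := by
    have hle : c * w x ≤ v x := (le_div_iff₀ (hpos x)).1 (hmin (mem_univ x))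
    linarith
  have hufix (x : G.Shift) : G.transfer f (fun y => v y + -c * w y) x = v x + -c * w x := by
    rw [transfer_add, transfer_const_mul, hvfix, hwfix]
  have hdense : Dense {x | v x + -c * w x = 0} :=
    dense_of_prepend_mem hG ⟨x₀, by simp [hc, (hpos x₀).ne']⟩ fun x hx e he =>
      eq_zero_prepend_of_transfer_eq_self hu hufix hx he
  have hclosed : IsClosed {x | v x + -c * w x = 0} :=
    isClosed_eq (hv.add (hw.const_mul _)) continuous_const
  refine ⟨c, fun x => ?_⟩
  have hx : x ∈ {x | v x + -c * w x = 0} := hclosed.closure_eq ▸ hdense x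
  linarith [show v x + -c * w x = 0 from hx]

end Transfer

variable {l : Fin k → ℝ} {q : DirEdge k → ℝ}

section ConformalVector

open Classical in
/-- The relation between the masses `q e` which a measure fixed by the dual transfer operator of
`-l` gives to the sets of paths starting with `e`. -/
def IsConformalVector (G : FinGraph V k) (l : Fin k → ℝ) (q : DirEdge k → ℝ) : Prop :=
  ∀ e, Real.exp (l e.1) * q e = ∑ e' with G.Adj e e', q e'

theorem IsConformalVector.exists_adj (hq : G.IsConformalVector l q) (hpos : ∀ e, 0 < q e)
    (e : DirEdge k) : ∃ e', G.Adj e e' := by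
  classical
  by_contra! hnone
  have hzero : Real.exp (l e.1) * q e = 0 := by simp [hq e, hnone]
  exact (mul_pos (Real.exp_pos _) (hpos e)).ne' hzero

theorem continuous_neg_onShift (l : Fin k → ℝ) : Continuous fun x => -G.onShift l x :=
  (continuous_onShift l).neg

open Classical in
theorem transfer_edgeFun (l : Fin k → ℝ) (g : DirEdge k → ℝ) (x : G.Shift) :
    G.transfer (fun y => -G.onShift l y) (fun y => g (y.1 0)) x =
      ∑ e with G.Adj e (x.1 0), Real.exp (-l e.1) * g e := by
  rw [transfer_eq_sum]
  refine Finset.sum_congr rfl fun e he => ?_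
  rw [onShift, prepend_zero (Finset.mem_filter.1 he).2]

/-- The function which a conformal vector induces through the reversal of directed edges; it is
fixed by the transfer operator because reversal transposes the adjacency matrix. -/
def reversedDensity (G : FinGraph V k) (l : Fin k → ℝ) (q : DirEdge k → ℝ) (x : G.Shift) : ℝ :=
  Real.exp (l (x.1 0).1) * q (x.1 0).bar

theorem continuous_reversedDensity (l : Fin k → ℝ) (q : DirEdge k → ℝ) :
    Continuous (G.reversedDensity l q) :=
  continuous_edgeFun fun e => Real.exp (l e.1) * q e.bar

theorem reversedDensity_pos (hpos : ∀ e, 0 < q e) (x : G.Shift) : 0 < G.reversedDensity l q x :=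
  mul_pos (Real.exp_pos _) (hpos _)

theorem IsConformalVector.transfer_reversedDensity (hq : G.IsConformalVector l q) (x : G.Shift) :
    G.transfer (fun y => -G.onShift l y) (G.reversedDensity l q) x = G.reversedDensity l q x := by
  classical
  calc G.transfer (fun y => -G.onShift l y) (G.reversedDensity l q) x
      = ∑ e with G.Adj e (x.1 0), Real.exp (-l e.1) * (Real.exp (l e.1) * q e.bar) :=
        transfer_edgeFun l (fun e => Real.exp (l e.1) * q e.bar) x
    _ = ∑ e with G.Adj e (x.1 0), q e.bar := by
        simp only [← mul_assoc, ← Real.exp_add, neg_add_cancel, Real.exp_zero, one_mul]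
    _ = ∑ e' with G.Adj (x.1 0).bar e', q e' := by
        refine Finset.sum_nbij' DirEdge.bar DirEdge.bar (fun e he => ?_) (fun e he => ?_)
          (fun e _ => e.bar_bar) (fun e _ => e.bar_bar) (fun e _ => rfl)
        · simpa [adj_bar_bar] using he
        · simpa [← adj_bar_bar (e := e.bar), DirEdge.bar_bar] using he
    _ = G.reversedDensity l q x := (hq (x.1 0).bar).symm

theorem IsConformalVector.exists_eq_const_mul (hG : G.IsIrreducible) {p : DirEdge k → ℝ}
    (hp : G.IsConformalVector l p) (hq : G.IsConformalVector l q) (hpos : ∀ e, 0 < q e) :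
    ∃ c, ∀ e, p e = c * q e := by
  obtain ⟨c, hc⟩ := exists_eq_const_mul_of_transfer_eq_self hG (continuous_reversedDensity l p)
    (continuous_reversedDensity l q) (reversedDensity_pos hpos) hp.transfer_reversedDensity
    hq.transfer_reversedDensity
  refine ⟨c, fun e => ?_⟩
  obtain ⟨x, hx⟩ := exists_path_from (hq.exists_adj hpos) e.bar
  have hcx := hc x
  simp only [reversedDensity, hx, DirEdge.bar_bar, mul_left_comm c] at hcx
  exact mul_left_cancel₀ (Real.exp_pos _).ne' hcx

end ConformalVector

section ConformalMeasure

/-- A probability measure fixed by the dual of the transfer operator of `f`. -/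
structure IsConformal (f : G.Shift → ℝ) (μ : Measure G.Shift) : Prop where
  isProbabilityMeasure : IsProbabilityMeasure μ
  integral_transfer : ∀ φ : C(G.Shift, ℝ), ∫ x, G.transfer f φ x ∂μ = ∫ x, φ x ∂μ

variable {μ ν : Measure G.Shift}

theorem IsConformalVector.exists_isConformal [NeZero k] (hq : G.IsConformalVector l q)
    (hpos : ∀ e, 0 < q e) : ∃ μ, G.IsConformal (fun x => -G.onShift l x) μ := by
  have : Nonempty G.Shift := (exists_path_from (hq.exists_adj hpos) (0, true)).nonempty
  obtain ⟨μ, hprob, hμ⟩ := exists_isProbabilityMeasure_integral_map_eq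
    (L := transferMap (continuous_neg_onShift (G := G) l))
    (w := ⟨_, continuous_reversedDensity l q⟩)
    (fun φ hφ => transfer_nonneg _ hφ) (reversedDensity_pos hpos)
    (ContinuousMap.ext hq.transfer_reversedDensity)
  exact ⟨μ, hprob, hμ⟩

theorem IsConformal.measureReal_zero_eq_and_shift_mem
    (hμ : G.IsConformal (fun x => -G.onShift l x) μ) (e : DirEdge k) {S : Set G.Shift}
    (hS : IsClopen S) :
    μ.real {x | x.1 0 = e ∧ G.shift x ∈ S} =
      Real.exp (-l e.1) * μ.real {x | G.Adj e (x.1 0) ∧ x ∈ S} := by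
  classical
  have hcyl : IsClopen {x : G.Shift | x.1 0 = e ∧ G.shift x ∈ S} :=
    (isClopen_setOf_coord 0 (· = e)).inter (hS.preimage continuous_shift)
  have htarget : IsClopen {x : G.Shift | G.Adj e (x.1 0) ∧ x ∈ S} :=
    (isClopen_setOf_coord 0 (G.Adj e)).inter hS
  have hindicator (y : G.Shift) : {x : G.Shift | x.1 0 = e ∧ G.shift x ∈ S}.indicator 1 y =
      (if y.1 0 = e then (1 : ℝ) else 0) * S.indicator 1 (G.shift y) := by
    by_cases h : y.1 0 = e <;> by_cases h' : G.shift y ∈ S <;> simp [h, h']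
  have htransfer (x : G.Shift) : G.transfer (fun y => -G.onShift l y)
      ({x : G.Shift | x.1 0 = e ∧ G.shift x ∈ S}.indicator 1) x =
      Real.exp (-l e.1) * {x : G.Shift | G.Adj e (x.1 0) ∧ x ∈ S}.indicator 1 x := by
    rw [funext hindicator, transfer_mul_comp_shift,
      transfer_edgeFun l (fun d => if d = e then (1 : ℝ) else 0)]
    by_cases h : G.Adj e (x.1 0) <;> by_cases h' : x ∈ S <;> simp [h, h']
  have hfix := hμ.integral_transfer ⟨_, hcyl.continuous_indicator continuous_one⟩
  simp only [ContinuousMap.coe_mk, htransfer, integral_const_mul] at hfix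
  rw [integral_indicator_one htarget.isOpen.measurableSet,
    integral_indicator_one hcyl.isOpen.measurableSet] at hfix
  exact hfix.symm

theorem IsConformal.isConformalVector (hμ : G.IsConformal (fun x => -G.onShift l x) μ) :
    G.IsConformalVector l fun e => μ.real {x | x.1 0 = e} := by
  classical
  intro e
  have := hμ.isProbabilityMeasure
  have hmass : μ.real {x | x.1 0 = e} = Real.exp (-l e.1) * μ.real {x | G.Adj e (x.1 0)} := by
    simpa using hμ.measureReal_zero_eq_and_shift_mem e isClopen_univ
  have hunion : {x : G.Shift | G.Adj e (x.1 0)} = ⋃ e' ∈ ({e' | G.Adj e e'} : Finset _),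
      {x : G.Shift | x.1 0 = e'} := by
    ext x
    simp
  beta_reduce
  rw [hmass, ← mul_assoc, ← Real.exp_add, add_neg_cancel, Real.exp_zero, one_mul, hunion,
    measureReal_biUnion_finset]
  · exact fun d _ d' _ hne => disjoint_left.2 fun x hd hd' => hne (hd.symm.trans hd')
  · exact fun d _ => (isClopen_setOf_coord 0 (· = d)).isOpen.measurableSet

theorem sum_measureReal_zero_eq [IsProbabilityMeasure μ] :
    ∑ e, μ.real {x : G.Shift | x.1 0 = e} = 1 := by
  rw [← measureReal_biUnion_finset, ← probReal_univ (μ := μ)]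
  · congr 1
    ext x
    simp
  · exact fun d _ d' _ hne => disjoint_left.2 fun x hd hd' => hne (hd.symm.trans hd')
  · exact fun d _ => (isClopen_setOf_coord 0 (· = d)).isOpen.measurableSet

theorem IsConformal.measureReal_zero_eq (hG : G.IsIrreducible) (hq : G.IsConformalVector l q)
    (hpos : ∀ e, 0 < q e) (hμ : G.IsConformal (fun x => -G.onShift l x) μ) (e : DirEdge k) :
    μ.real {x | x.1 0 = e} = q e / ∑ d, q d := by
  have := hμ.isProbabilityMeasure
  obtain ⟨c, hc⟩ := hμ.isConformalVector.exists_eq_const_mul hG hq hpos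
  have hsum : c * ∑ d, q d = 1 := by
    rw [Finset.mul_sum, ← sum_measureReal_zero_eq (μ := μ)]
    exact Finset.sum_congr rfl fun d _ => (hc d).symm
  rw [hc, eq_div_iff (right_ne_zero_of_mul_eq_one hsum), mul_right_comm, hsum, one_mul]

/-- The set of paths whose first `n` edges are those of the sequence `z`. -/
def cylinder (G : FinGraph V k) (n : ℕ) (z : ℕ → DirEdge k) : Set G.Shift :=
  {x | ∀ i < n, x.1 i = z i}

theorem cylinder_zero (z : ℕ → DirEdge k) : G.cylinder 0 z = univ := by
  simp [cylinder]

theorem cylinder_succ (n : ℕ) (z : ℕ → DirEdge k) :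
    G.cylinder (n + 1) z = {x | x.1 0 = z 0 ∧ G.shift x ∈ G.cylinder n fun i => z (i + 1)} := by
  ext x
  simp only [cylinder, mem_ofPred_eq, shift, Nat.forall_lt_succ_left]

theorem isClopen_cylinder (n : ℕ) (z : ℕ → DirEdge k) : IsClopen (G.cylinder n z) := by
  induction n generalizing z with
  | zero => simpa only [cylinder_zero] using isClopen_univ
  | succ n ih =>
    rw [cylinder_succ]
    exact (isClopen_setOf_coord 0 (· = z 0)).inter ((ih _).preimage continuous_shift)

theorem cylinder_inter_of_mem {m n : ℕ} {y z : ℕ → DirEdge k} {x : G.Shift}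
    (hy : x ∈ G.cylinder m y) (hz : x ∈ G.cylinder n z) :
    G.cylinder m y ∩ G.cylinder n z = G.cylinder (max m n) x.1 := by
  ext x'
  simp only [cylinder, mem_inter_iff, mem_ofPred_eq, lt_max_iff, or_imp, forall_and]
  refine and_congr (forall₂_congr fun i hi => ?_) (forall₂_congr fun i hi => ?_)
  · rw [hy i hi]
  · rw [hz i hi]

theorem isPiSystem_cylinder : IsPiSystem {S | ∃ n z, S = G.cylinder n z} := by
  rintro _ ⟨m, y, rfl⟩ _ ⟨n, z, rfl⟩ ⟨x, hxy, hxz⟩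
  exact ⟨_, _, cylinder_inter_of_mem hxy hxz⟩

theorem generateFrom_cylinder :
    MeasurableSpace.generateFrom {S | ∃ n z, S = G.cylinder n z} = Subtype.instMeasurableSpace := by
  have hbasis : TopologicalSpace.IsTopologicalBasis {S | ∃ n z, S = G.cylinder n z} := by
    convert (PiNat.isTopologicalBasis_cylinders fun _ : ℕ => DirEdge k).isInducing
      (f := (Subtype.val : G.Shift → ℕ → DirEdge k)) IsInducing.subtypeVal using 1
    ext S
    constructor
    · rintro ⟨n, z, rfl⟩
      exact ⟨_, ⟨z, n, rfl⟩, rfl⟩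
    · rintro ⟨_, ⟨z, n, rfl⟩, rfl⟩
      exact ⟨n, z, rfl⟩
  have : SecondCountableTopology G.Shift := IsInducing.subtypeVal.secondCountableTopology
  rw [← hbasis.borel_eq_generateFrom]
  exact (BorelSpace.measurable_eq (α := G.Shift)).symm

theorem IsConformal.measureReal_cylinder_succ
    (hμ : G.IsConformal (fun x => -G.onShift l x) μ) (n : ℕ) {z : ℕ → DirEdge k}
    (hz : G.Adj (z 0) (z 1)) :
    μ.real (G.cylinder (n + 2) z) =
      Real.exp (-l (z 0).1) * μ.real (G.cylinder (n + 1) fun i => z (i + 1)) := by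
  rw [cylinder_succ, hμ.measureReal_zero_eq_and_shift_mem _ (isClopen_cylinder _ _)]
  congr 2
  refine inter_eq_right.2 fun x hx => ?_
  have hx₀ : x.1 0 = z 1 := hx 0 n.succ_pos
  change G.Adj (z 0) (x.1 0)
  rwa [hx₀]

theorem cylinder_eq_empty {n : ℕ} {z : ℕ → DirEdge k} (hz : ¬ G.Adj (z 0) (z 1)) :
    G.cylinder (n + 2) z = ∅ :=
  eq_empty_of_forall_notMem fun x hx => hz (hx 0 (by omega) ▸ hx 1 (by omega) ▸ x.2 0)

theorem IsConformal.measureReal_cylinder_eq (hG : G.IsIrreducible)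
    (hq : G.IsConformalVector l q) (hpos : ∀ e, 0 < q e)
    (hμ : G.IsConformal (fun x => -G.onShift l x) μ)
    (hν : G.IsConformal (fun x => -G.onShift l x) ν) (n : ℕ) (z : ℕ → DirEdge k) :
    μ.real (G.cylinder (n + 1) z) = ν.real (G.cylinder (n + 1) z) := by
  induction n generalizing z with
  | zero =>
    simpa [cylinder] using (hμ.measureReal_zero_eq hG hq hpos (z 0)).trans
      (hν.measureReal_zero_eq hG hq hpos (z 0)).symm
  | succ n ih =>
    by_cases hz : G.Adj (z 0) (z 1)
    · rw [hμ.measureReal_cylinder_succ n hz, hν.measureReal_cylinder_succ n hz, ih]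
    · rw [cylinder_eq_empty hz, measureReal_empty, measureReal_empty]

theorem IsConformal.eq (hG : G.IsIrreducible) (hq : G.IsConformalVector l q)
    (hpos : ∀ e, 0 < q e) (hμ : G.IsConformal (fun x => -G.onShift l x) μ)
    (hν : G.IsConformal (fun x => -G.onShift l x) ν) : μ = ν := by
  have := hμ.isProbabilityMeasure
  have := hν.isProbabilityMeasure
  refine ext_of_generate_finite _ generateFrom_cylinder.symm isPiSystem_cylinder ?_ (by simp)
  rintro _ ⟨n, z, rfl⟩
  cases n with
  | zero => simp [cylinder_zero]
  | succ n =>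
    rw [← measureReal_eq_measureReal_iff]
    exact hμ.measureReal_cylinder_eq hG hq hpos hν n z

end ConformalMeasure

section EquilibriumState

variable {f v w : G.Shift → ℝ} {m : Measure G.Shift}

theorem IsEquilibriumState.isProbabilityMeasure (hm : G.IsEquilibriumState f m) :
    IsProbabilityMeasure m := by
  obtain ⟨v, μ, hv, -, _, -, rfl⟩ := hm
  exact isProbabilityMeasure_withDensity_div_integral v.continuous hv

theorem isEquilibriumState_withDensity {μ : Measure G.Shift} (hμ : G.IsConformal f μ)
    (hw : Continuous w) (hpos : ∀ x, 0 < w x) (hfix : ∀ x, G.transfer f w x = w x) :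
    G.IsEquilibriumState f (μ.withDensity fun x => ENNReal.ofReal (w x / ∫ y, w y ∂μ)) :=
  ⟨⟨w, hw⟩, μ, hpos, hfix, hμ.isProbabilityMeasure, hμ.integral_transfer, rfl⟩

theorem IsEquilibriumState.exists_eq_withDensity (hG : G.IsIrreducible) (hw : Continuous w)
    (hpos : ∀ x, 0 < w x) (hfix : ∀ x, G.transfer f w x = w x)
    (hm : G.IsEquilibriumState f m) :
    ∃ μ, G.IsConformal f μ ∧
      m = μ.withDensity fun x => ENNReal.ofReal (w x / ∫ y, w y ∂μ) := by
  obtain ⟨v, μ, hv, hvfix, hprob, hdual, rfl⟩ := hm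
  refine ⟨μ, ⟨hprob, hdual⟩, ?_⟩
  obtain ⟨c, hc⟩ := exists_eq_const_mul_of_transfer_eq_self hG v.continuous hw hpos hvfix hfix
  obtain ⟨x⟩ := μ.nonempty_of_neZero
  have hc₀ : c ≠ 0 := left_ne_zero_of_mul (hc x ▸ (hv x).ne')
  simp only [hc, integral_const_mul, mul_div_mul_left _ _ hc₀]

theorem IsConformalVector.existsUnique_isEquilibriumState [NeZero k] (hG : G.IsIrreducible)
    (hq : G.IsConformalVector l q) (hpos : ∀ e, 0 < q e) :
    ∃! m, G.IsEquilibriumState (fun x => -G.onShift l x) m := by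
  have hw := continuous_reversedDensity (G := G) l q
  have hwpos := reversedDensity_pos (G := G) (l := l) hpos
  obtain ⟨μ, hμ⟩ := hq.exists_isConformal hpos
  refine ⟨_, isEquilibriumState_withDensity hμ hw hwpos hq.transfer_reversedDensity, ?_⟩
  intro m hm
  obtain ⟨ν, hν, rfl⟩ := hm.exists_eq_withDensity hG hw hwpos hq.transfer_reversedDensity
  rw [hν.eq hG hq hpos hμ]

theorem IsConformalVector.isEquilibriumState_eqState [NeZero k] (hG : G.IsIrreducible)
    (hq : G.IsConformalVector l q) (hpos : ∀ e, 0 < q e) :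
    G.IsEquilibriumState (fun x => -G.onShift l x) (G.eqState l) :=
  Classical.epsilon_spec (hq.existsUnique_isEquilibriumState hG hpos).exists

theorem IsEquilibriumState.hasGeometricCorrelations (hG : G.IsIrreducible)
    (hw : Continuous w) (hpos : ∀ x, 0 < w x) (hfix : ∀ x, G.transfer f w x = w x)
    (hm : G.IsEquilibriumState f m) {g : G.Shift → ℝ} (hg : Continuous g) {r : ℝ}
    (hr : ∀ x, G.transfer f (fun y => w y * g y) x = r * (w x * g x)) :
    HasGeometricCorrelations G.shift m g r := by
  obtain ⟨μ, hμ, rfl⟩ := hm.exists_eq_withDensity hG hw hpos hfix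
  intro u hu
  have htransfer (x : G.Shift) :
      G.transfer f (fun y => w y * (g y * u (G.shift y))) x = r * (w x * (g x * u x)) := by
    simp only [← mul_assoc]
    rw [transfer_mul_comp_shift, hr, ← mul_assoc]
  have hdual : ∫ x, G.transfer f (fun y => w y * (g y * u (G.shift y))) x ∂μ =
      ∫ x, w x * (g x * u (G.shift x)) ∂μ :=
    hμ.integral_transfer ⟨_, hw.mul (hg.mul (hu.comp continuous_shift))⟩
  simp only [htransfer, integral_const_mul] at hdual
  rw [integral_withDensity_div_integral hw hpos, integral_withDensity_div_integral hw hpos,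
    ← hdual, mul_div_assoc]

theorem IsEquilibriumState.integral_comp_shift (hm : G.IsEquilibriumState f m)
    {u : G.Shift → ℝ} (hu : Continuous u) : ∫ x, u (G.shift x) ∂m = ∫ x, u x ∂m := by
  obtain ⟨v, μ, hv, hvfix, -, hdual, rfl⟩ := hm
  have hfix : ∫ x, G.transfer f (fun y => v y * u (G.shift y)) x ∂μ =
      ∫ x, v x * u (G.shift x) ∂μ :=
    hdual ⟨_, v.continuous.mul (hu.comp continuous_shift)⟩
  simp only [transfer_mul_comp_shift, hvfix] at hfix
  rw [integral_withDensity_div_integral v.continuous hv,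
    integral_withDensity_div_integral v.continuous hv, hfix]

end EquilibriumState

end FinGraph

theorem exists_pos_forall_le_of_finite {ι : Type*} [Finite ι] {f : ι → ℝ} (hf : ∀ i, 0 < f i) :
    ∃ δ > 0, ∀ i, δ ≤ f i := by
  rcases isEmpty_or_nonempty ι with hempty | hne
  · exact ⟨1, one_pos, hempty.elim⟩
  · obtain ⟨i, hi⟩ := Finite.exists_min f
    exact ⟨f i, hf i, hi⟩

theorem tendsto_one_div_mul_log_of_exp_le_of_le {N : ℝ → ℝ} {c C : ℝ} (hc : 0 < c)
    (hlow : ∀ᶠ T in atTop, c * Real.exp T ≤ N T)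
    (hup : ∀ᶠ T in atTop, N T ≤ C * (T * Real.exp T)) :
    Tendsto (fun T => 1 / T * Real.log (N T)) atTop (𝓝 1) := by
  have hlog : Tendsto (fun T : ℝ => Real.log T / T) atTop (𝓝 0) := by
    simpa using Real.tendsto_pow_log_div_mul_add_atTop 1 0 1 one_ne_zero
  have hlimit (a : ℝ) : Tendsto (fun T : ℝ => 1 + a / T) atTop (𝓝 1) := by
    simpa using (tendsto_const_nhds (x := a)).div_atTop tendsto_id |>.const_add 1
  have hlimit_log : Tendsto (fun T : ℝ => 1 + Real.log C / T + Real.log T / T) atTop (𝓝 1) := by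
    simpa using (hlimit (Real.log C)).add hlog
  refine tendsto_of_tendsto_of_tendsto_of_le_of_le' (hlimit (Real.log c)) hlimit_log ?_ ?_
  · filter_upwards [eventually_gt_atTop 0, hlow] with T hT hlowT
    have hle : Real.log c + T ≤ Real.log (N T) := by
      have hlog_eq : Real.log (c * Real.exp T) = Real.log c + T := by
        rw [Real.log_mul hc.ne' (Real.exp_pos T).ne', Real.log_exp]
      exact hlog_eq ▸ Real.log_le_log (by positivity) hlowT
    rw [one_div_mul_eq_div, le_div_iff₀ hT]
    field_simp
    linarith
  · filter_upwards [eventually_gt_atTop 0, hlow, hup] with T hT hlowT hupT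
    have hN : 0 < N T := lt_of_lt_of_le (by positivity) hlowT
    have hC : 0 < C := pos_of_mul_pos_left (hN.trans_le hupT) (by positivity)
    have hle : Real.log (N T) ≤ Real.log C + (Real.log T + T) := by
      have hlog_eq : Real.log (C * (T * Real.exp T)) = Real.log C + (Real.log T + T) := by
        rw [Real.log_mul hC.ne' (by positivity), Real.log_mul hT.ne' (Real.exp_pos T).ne',
          Real.log_exp]
      exact hlog_eq ▸ Real.log_le_log hN hupT
    rw [one_div_mul_eq_div, div_le_iff₀ hT]
    field_simp
    linarith

namespace FinGraph

variable {V : Type} {k : ℕ} {G : FinGraph V k} {l : Fin k → ℝ} {q : DirEdge k → ℝ}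

section Walks

/-- The length of the walk `e :: p`, without its last edge. -/
def walkLength (l : Fin k → ℝ) : DirEdge k → List (DirEdge k) → ℝ
  | _, [] => 0
  | e, d :: p => l e.1 + walkLength l d p

theorem walkLength_nonneg (hl : ∀ i, 0 < l i) (e : DirEdge k) (p : List (DirEdge k)) :
    0 ≤ walkLength l e p := by
  induction p generalizing e with
  | nil => exact le_rfl
  | cons d p ih => exact add_nonneg (hl _).le (ih d)

theorem walkLength_append (l : Fin k → ℝ) (e : DirEdge k) (p r : List (DirEdge k)) :
    walkLength l e (p ++ r) = walkLength l e p + walkLength l (p.getLastD e) r := by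
  induction p generalizing e with
  | nil => simp [walkLength]
  | cons d p ih => simp only [List.cons_append, walkLength, ih, List.getLastD_cons, add_assoc]

theorem walkLength_ofFn (l : Fin k → ℝ) {n : ℕ} (f : Fin (n + 1) → DirEdge k) :
    walkLength l (f 0) (List.ofFn fun i : Fin n => f i.succ) =
      ∑ i : Fin n, l (f i.castSucc).1 := by
  induction n with
  | zero => simp [walkLength]
  | succ n ih =>
    rw [List.ofFn_succ, Fin.sum_univ_succ]
    exact congrArg (l (f 0).1 + ·) (ih fun i => f i.succ)

theorem getLastD_append {α : Type*} (p r : List α) (a : α) :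
    (p ++ r).getLastD a = r.getLastD (p.getLastD a) := by
  induction p generalizing a with
  | nil => rfl
  | cons b p ih => rw [List.cons_append, List.getLastD_cons, ih, List.getLastD_cons]

theorem isChain_cons_append {e : DirEdge k} {p r : List (DirEdge k)}
    (hp : List.IsChain G.Adj (e :: p)) (hr : List.IsChain G.Adj (p.getLastD e :: r)) :
    List.IsChain G.Adj (e :: (p ++ r)) := by
  induction p generalizing e with
  | nil => simpa using hr
  | cons d p ih =>
    obtain ⟨hed, hp⟩ := List.isChain_cons_cons.1 hp
    exact List.isChain_cons_cons.2 ⟨hed, ih hp (by rwa [List.getLastD_cons] at hr)⟩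

/-- The continuations `p` of `e` to a walk `e :: p` without backtracking of length less than `T`. -/
def walks (G : FinGraph V k) (l : Fin k → ℝ) (e : DirEdge k) (T : ℝ) : Set (List (DirEdge k)) :=
  {p | List.IsChain G.Adj (e :: p) ∧ walkLength l e p < T}

theorem walks_of_nonpos (hl : ∀ i, 0 < l i) (e : DirEdge k) {T : ℝ} (hT : T ≤ 0) :
    G.walks l e T = ∅ :=
  eq_empty_of_forall_notMem fun p hp => (hT.trans (walkLength_nonneg hl e p)).not_gt hp.2

/-- A walk is trivial or consists of a first step and a walk from the next edge. -/
def walksEquiv (G : FinGraph V k) (l : Fin k → ℝ) (e : DirEdge k) {T : ℝ} (hT : 0 < T) :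
    Option (Σ d : {d // G.Adj e d}, G.walks l d.1 (T - l e.1)) ≃ G.walks l e T where
  toFun
    | none => ⟨[], List.isChain_singleton e, hT⟩
    | some ⟨d, p⟩ => ⟨d.1 :: p.1, List.isChain_cons_cons.2 ⟨d.2, p.2.1⟩,
        lt_sub_iff_add_lt'.1 p.2.2⟩
  invFun
    | ⟨[], _⟩ => none
    | ⟨d :: p, hp⟩ => some ⟨⟨d, (List.isChain_cons_cons.1 hp.1).1⟩,
        ⟨p, (List.isChain_cons_cons.1 hp.1).2, lt_sub_iff_add_lt'.2 hp.2⟩⟩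
  left_inv x := by rcases x with _ | ⟨d, p⟩ <;> rfl
  right_inv x := by rcases x with ⟨_ | ⟨d, p⟩, hp⟩ <;> rfl

theorem walk_induction (hl : ∀ i, 0 < l i) {P : DirEdge k → ℝ → Prop}
    (hnonpos : ∀ e T, T ≤ 0 → P e T)
    (hstep : ∀ e T, 0 < T → (∀ d, P d (T - l e.1)) → P e T) (e : DirEdge k) (T : ℝ) : P e T := by
  obtain ⟨δ, hδ, hδl⟩ := exists_pos_forall_le_of_finite hl
  have hmul (n : ℕ) (e : DirEdge k) (T : ℝ) (hT : T ≤ n * δ) : P e T := by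
    induction n generalizing e T with
    | zero => exact hnonpos e T (by simpa using hT)
    | succ n ih =>
      rcases le_or_gt T 0 with hT₀ | hT₀
      · exact hnonpos e T hT₀
      · refine hstep e T hT₀ fun d => ih d _ ?_
        push_cast at hT
        linarith [hδl e.1]
  obtain ⟨n, hn⟩ := exists_nat_ge (T / δ)
  exact hmul n e T ((div_le_iff₀ hδ).1 hn)

theorem finite_walks (hl : ∀ i, 0 < l i) (e : DirEdge k) (T : ℝ) : (G.walks l e T).Finite := by
  induction e, T using walk_induction hl with
  | hnonpos e T hT => simp [walks_of_nonpos hl e hT]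
  | hstep e T hT ih =>
    have (d : {d // G.Adj e d}) : Finite (G.walks l d.1 (T - l e.1)) := ih d.1
    exact Finite.of_equiv _ (G.walksEquiv l e hT)

open Classical in
theorem ncard_walks (hl : ∀ i, 0 < l i) (e : DirEdge k) {T : ℝ} (hT : 0 < T) :
    (G.walks l e T).ncard = 1 + ∑ d with G.Adj e d, (G.walks l d (T - l e.1)).ncard := by
  have (d : {d // G.Adj e d}) : Finite (G.walks l d.1 (T - l e.1)) := finite_walks hl _ _
  rw [← Nat.card_coe_set_eq, ← Nat.card_congr (G.walksEquiv l e hT), Finite.card_option,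
    Nat.card_sigma, add_comm, Finset.sum_subtype (F := inferInstance) (p := G.Adj e) _ (by simp)]
  simp only [Nat.card_coe_set_eq]

open Classical in
theorem IsConformalVector.sum_mul_exp_sub (hq : G.IsConformalVector l q) (c T : ℝ)
    (e : DirEdge k) :
    ∑ d with G.Adj e d, c * (q d * Real.exp (T - l e.1)) = c * (q e * Real.exp T) := by
  rw [← Finset.mul_sum, ← Finset.sum_mul, ← hq e, mul_right_comm, ← Real.exp_add,
    add_sub_cancel, mul_comm (q e)]

theorem IsConformalVector.le_ncard_walks (hl : ∀ i, 0 < l i) (hq : G.IsConformalVector l q)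
    {c : ℝ} (hcq : ∀ e, 0 ≤ c * q e) (hc : ∀ e, c * q e * Real.exp (l e.1) ≤ 1) (e : DirEdge k)
    {T : ℝ} (hT : 0 < T) : c * (q e * Real.exp T) ≤ (G.walks l e T).ncard := by
  classical
  induction e, T using walk_induction hl with
  | hnonpos e T hT' => exact absurd hT hT'.not_gt
  | hstep e T _ ih =>
    rw [ncard_walks hl e hT]
    push_cast
    rcases le_or_gt (T - l e.1) 0 with hle | hlt
    · calc c * (q e * Real.exp T)
          ≤ c * q e * Real.exp (l e.1) := by
            rw [← mul_assoc]
            exact mul_le_mul_of_nonneg_left (Real.exp_le_exp.2 (by linarith)) (hcq e)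
        _ ≤ 1 := hc e
        _ ≤ _ := le_add_of_nonneg_right (by positivity)
    · rw [← hq.sum_mul_exp_sub]
      exact (Finset.sum_le_sum fun d _ => ih d hlt).trans (le_add_of_nonneg_left zero_le_one)

theorem IsConformalVector.ncard_walks_le (hl : ∀ i, 0 < l i) (hq : G.IsConformalVector l q)
    {C δ : ℝ} (hδ : ∀ i, δ ≤ l i) (hC : ∀ e, 1 ≤ C * q e) (e : DirEdge k) (n : ℕ) {T : ℝ}
    (hT : T ≤ n * δ) : (G.walks l e T).ncard ≤ n * (C * (q e * Real.exp T)) := by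
  classical
  have hCq (d : DirEdge k) (S : ℝ) : 0 ≤ C * (q d * Real.exp S) := by
    rw [← mul_assoc]
    exact mul_nonneg (zero_le_one.trans (hC d)) (Real.exp_pos S).le
  induction n generalizing e T with
  | zero => simp [walks_of_nonpos hl e (by simpa using hT)]
  | succ n ih =>
    rcases le_or_gt T 0 with hT₀ | hT₀
    · simpa [walks_of_nonpos hl e hT₀] using mul_nonneg n.cast_add_one_pos.le (hCq e T)
    · have hone : 1 ≤ C * (q e * Real.exp T) := by
        rw [← mul_assoc]
        exact one_le_mul_of_one_le_of_one_le (hC e) (Real.one_le_exp hT₀.le)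
      have hstep : ∑ d with G.Adj e d, ((G.walks l d (T - l e.1)).ncard : ℝ) ≤
          n * (C * (q e * Real.exp T)) := by
        rw [← hq.sum_mul_exp_sub, Finset.mul_sum]
        refine Finset.sum_le_sum fun d _ => ih d ?_
        push_cast at hT
        linarith [hδ e.1]
      rw [ncard_walks hl e hT₀]
      push_cast
      linarith

end Walks

section Cycles

/-- The closed cycles whose number defines the entropy. -/
def cyclesBelow (G : FinGraph V k) (l : Fin k → ℝ) (T : ℝ) : Set G.ClosedCycle :=
  {γ | γ.length l < T}

theorem ClosedCycle.ext_of_ofFn_eq {γ γ' : G.ClosedCycle}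
    (h : List.ofFn γ.edge = List.ofFn γ'.edge) : γ = γ' := by
  obtain ⟨n, pos, f, hc, hs⟩ := γ
  obtain ⟨n', pos', f', hc', hs'⟩ := γ'
  obtain rfl : n = n' := by simpa using congrArg List.length h
  obtain rfl : f = f' := List.ofFn_injective h
  rfl

theorem mapsTo_ofFn_cyclesBelow (G : FinGraph V k) (l : Fin k → ℝ) (T : ℝ) :
    MapsTo (fun γ : G.ClosedCycle => List.ofFn γ.edge) (G.cyclesBelow l T)
      (⋃ e ∈ (Finset.univ : Finset (DirEdge k)), List.cons e '' G.walks l e T) := by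
  intro γ hγ
  simp only [Finset.mem_univ, iUnion_true, mem_iUnion]
  refine ⟨γ.edge 0, List.ofFn fun i : Fin γ.n => γ.edge i.succ, ⟨?_, ?_⟩, List.ofFn_succ.symm⟩
  · rw [← List.ofFn_succ, List.isChain_ofFn]
    exact fun i hi => γ.step ⟨i, by omega⟩
  · exact (walkLength_ofFn l γ.edge).trans_lt hγ

theorem finite_biUnion_walks (hl : ∀ i, 0 < l i) (T : ℝ) :
    (⋃ e ∈ (Finset.univ : Finset (DirEdge k)), List.cons e '' G.walks l e T).Finite :=
  Finset.univ.finite_toSet.biUnion fun e _ => (finite_walks hl e T).image _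

theorem finite_cyclesBelow (hl : ∀ i, 0 < l i) (T : ℝ) : (G.cyclesBelow l T).Finite :=
  Finite.of_injOn (mapsTo_ofFn_cyclesBelow G l T) (fun _ _ _ _ => ClosedCycle.ext_of_ofFn_eq)
    (finite_biUnion_walks hl T)

theorem ncard_cyclesBelow_le (hl : ∀ i, 0 < l i) (T : ℝ) :
    (G.cyclesBelow l T).ncard ≤ ∑ e, (G.walks l e T).ncard :=
  calc (G.cyclesBelow l T).ncard
      ≤ (⋃ e ∈ (Finset.univ : Finset (DirEdge k)), List.cons e '' G.walks l e T).ncard :=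
        ncard_le_ncard_of_injOn _ (mapsTo_ofFn_cyclesBelow G l T)
          (fun _ _ _ _ => ClosedCycle.ext_of_ofFn_eq) (finite_biUnion_walks hl T)
    _ ≤ ∑ e, (List.cons e '' G.walks l e T).ncard := Finset.set_ncard_biUnion_le _ _
    _ ≤ ∑ e, (G.walks l e T).ncard :=
        Finset.sum_le_sum fun e _ => ncard_image_le (finite_walks hl e T)

/-- The closed cycle with the edges of the list `e :: p`. -/
def cycleOfWalk (e : DirEdge k) (p : List (DirEdge k)) (hp : p ≠ [])
    (hchain : List.IsChain G.Adj (e :: p)) (hlast : p.getLastD e = e) : G.ClosedCycle where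
  n := p.length
  pos := List.length_pos_of_ne_nil hp
  edge := (e :: p).get
  closed := by
    rw [← List.getLast_eq_getLastD (List.cons_ne_nil _ _), List.getLast_eq_getElem] at hlast
    exact hlast
  step i := List.isChain_iff_getElem.1 hchain i.1 (by simp)

variable {e : DirEdge k} {p : List (DirEdge k)} {hp : p ≠ []}
  {hchain : List.IsChain G.Adj (e :: p)} {hlast : p.getLastD e = e}

theorem length_cycleOfWalk (l : Fin k → ℝ) :
    (cycleOfWalk e p hp hchain hlast).length l = walkLength l e p := by
  refine (walkLength_ofFn l (e :: p).get).symm.trans ?_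
  congr 1
  exact List.ofFn_get p

theorem ofFn_cycleOfWalk : List.ofFn (cycleOfWalk e p hp hchain hlast).edge = e :: p :=
  List.ofFn_get (e :: p)

theorem exists_closing_walk (hG : G.IsIrreducible) (hadj : ∀ e, ∃ e', G.Adj e e')
    (a e : DirEdge k) : ∃ r ≠ [], List.IsChain G.Adj (a :: r) ∧ r.getLastD a = e := by
  obtain ⟨b, hab⟩ := hadj a
  obtain ⟨r, hchain, hlast⟩ := List.exists_isChain_cons_of_relationReflTransGen (hG b e)
  exact ⟨b :: r, List.cons_ne_nil _ _, List.isChain_cons_cons.2 ⟨hab, hchain⟩, by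
    rwa [List.getLastD_cons, ← List.getLast_eq_getLastD (List.cons_ne_nil _ _)]⟩

theorem ncard_walks_ending_le (hl : ∀ i, 0 < l i) {a e : DirEdge k} {r : List (DirEdge k)}
    (hr : r ≠ []) (hchain : List.IsChain G.Adj (a :: r)) (hlast : r.getLastD a = e) {K : ℝ}
    (hK : walkLength l a r ≤ K) (T : ℝ) :
    {p ∈ G.walks l e (T - K) | p.getLastD e = a}.ncard ≤ (G.cyclesBelow l T).ncard := by
  have hclose (p : {p ∈ G.walks l e (T - K) | p.getLastD e = a}) :
      ∃ γ ∈ G.cyclesBelow l T, List.ofFn γ.edge = e :: (p.1 ++ r) := by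
    obtain ⟨p, ⟨hp, hlen⟩, rfl⟩ := p
    refine ⟨cycleOfWalk e (p ++ r) (by simp [hr]) (isChain_cons_append hp hchain) ?_, ?_,
      ofFn_cycleOfWalk⟩
    · rwa [getLastD_append]
    · change ClosedCycle.length _ l < T
      rw [length_cycleOfWalk, walkLength_append]
      linarith
  choose γ hγ hedge using hclose
  have : Finite (G.cyclesBelow l T) := finite_cyclesBelow hl T
  rw [← Nat.card_coe_set_eq, ← Nat.card_coe_set_eq]
  refine Nat.card_le_card_of_injective (fun p => ⟨γ p, hγ p⟩) fun p p' h => Subtype.ext ?_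
  have hcons := congrArg (fun γ : G.ClosedCycle => List.ofFn γ.edge) (congrArg Subtype.val h)
  simp only [hedge, List.cons.injEq, true_and] at hcons
  exact List.append_cancel_right hcons

theorem exists_ncard_walks_le (hl : ∀ i, 0 < l i) (hG : G.IsIrreducible)
    (hadj : ∀ e, ∃ e', G.Adj e e') (e : DirEdge k) :
    ∃ K, ∀ T, (G.walks l e (T - K)).ncard ≤
      Fintype.card (DirEdge k) * (G.cyclesBelow l T).ncard := by
  choose r hr hchain hlast using fun a => exists_closing_walk hG hadj a e
  obtain ⟨K, hK⟩ := (finite_range fun a => walkLength l a (r a)).bddAbove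
  refine ⟨K, fun T => ?_⟩
  have hcover : G.walks l e (T - K) = ⋃ a ∈ (Finset.univ : Finset (DirEdge k)),
      {p ∈ G.walks l e (T - K) | p.getLastD e = a} := by
    ext p
    simp
  calc (G.walks l e (T - K)).ncard
      ≤ ∑ a, {p ∈ G.walks l e (T - K) | p.getLastD e = a}.ncard := by
        conv_lhs => rw [hcover]
        exact Finset.set_ncard_biUnion_le _ _
    _ ≤ ∑ _a : DirEdge k, (G.cyclesBelow l T).ncard := Finset.sum_le_sum fun a _ =>
        ncard_walks_ending_le hl (hr a) (hchain a) (hlast a) (hK (mem_range_self a)) T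
    _ = _ := by simp

end Cycles

section Entropy

theorem IsConformalVector.exists_mul_exp_le_ncard_cyclesBelow [NeZero k] (hl : ∀ i, 0 < l i)
    (hG : G.IsIrreducible) (hq : G.IsConformalVector l q) (hpos : ∀ e, 0 < q e) :
    ∃ c > 0, ∀ᶠ T in atTop, c * Real.exp T ≤ (G.cyclesBelow l T).ncard := by
  let e : DirEdge k := (0, true)
  obtain ⟨K, hK⟩ := exists_ncard_walks_le hl hG (hq.exists_adj hpos) e
  obtain ⟨c, hc, hcle⟩ := exists_pos_forall_le_of_finite
    (f := fun e => 1 / (q e * Real.exp (l e.1)))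
    fun e => one_div_pos.2 (mul_pos (hpos e) (Real.exp_pos _))
  have hcard : (0 : ℝ) < Fintype.card (DirEdge k) := by
    exact_mod_cast Fintype.card_pos_iff.2 ⟨e⟩
  refine ⟨c * q e * Real.exp (-K) / Fintype.card (DirEdge k),
    div_pos (mul_pos (mul_pos hc (hpos e)) (Real.exp_pos _)) hcard, ?_⟩
  filter_upwards [eventually_gt_atTop K] with T hT
  have hwalks : c * (q e * Real.exp (T - K)) ≤ (G.walks l e (T - K)).ncard :=
    hq.le_ncard_walks hl (fun e => (mul_pos hc (hpos e)).le)
      (fun e => by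
        rw [mul_assoc]
        exact (le_div_iff₀ (mul_pos (hpos e) (Real.exp_pos _))).1 (hcle e))
      e (sub_pos.2 hT)
  have hcycles : ((G.walks l e (T - K)).ncard : ℝ) ≤
      Fintype.card (DirEdge k) * (G.cyclesBelow l T).ncard := mod_cast hK T
  rw [div_mul_eq_mul_div, div_le_iff₀' hcard]
  calc c * q e * Real.exp (-K) * Real.exp T = c * (q e * Real.exp (T - K)) := by
        rw [sub_eq_neg_add, Real.exp_add]; ring
    _ ≤ _ := hwalks.trans hcycles

theorem IsConformalVector.exists_ncard_cyclesBelow_le (hl : ∀ i, 0 < l i)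
    (hq : G.IsConformalVector l q) (hpos : ∀ e, 0 < q e) :
    ∃ C, ∀ᶠ T in atTop, (G.cyclesBelow l T).ncard ≤ C * (T * Real.exp T) := by
  obtain ⟨δ, hδ, hδl⟩ := exists_pos_forall_le_of_finite hl
  obtain ⟨c, hc, hcq⟩ := exists_pos_forall_le_of_finite hpos
  have hC (e : DirEdge k) : 1 ≤ c⁻¹ * q e := (le_inv_mul_iff₀ hc).2 (by simpa using hcq e)
  refine ⟨2 / δ * (c⁻¹ * ∑ e, q e), ?_⟩
  filter_upwards [eventually_ge_atTop δ] with T hT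
  have hceil : T ≤ ⌈T / δ⌉₊ * δ := (div_le_iff₀ hδ).1 (Nat.le_ceil _)
  have hceil_le : (⌈T / δ⌉₊ : ℝ) ≤ 2 / δ * T := by
    have hone : 1 ≤ T / δ := (one_le_div hδ).2 hT
    have hlt := Nat.ceil_lt_add_one (zero_le_one.trans hone)
    rw [div_mul_eq_mul_div, mul_div_assoc]
    linarith
  have hsum : 0 ≤ ∑ e, q e := Finset.sum_nonneg fun e _ => (hpos e).le
  calc ((G.cyclesBelow l T).ncard : ℝ)
      ≤ ∑ e, ((G.walks l e T).ncard : ℝ) := mod_cast ncard_cyclesBelow_le hl T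
    _ ≤ ∑ e, ⌈T / δ⌉₊ * (c⁻¹ * (q e * Real.exp T)) :=
        Finset.sum_le_sum fun e _ => hq.ncard_walks_le hl hδl hC e _ hceil
    _ = ⌈T / δ⌉₊ * (c⁻¹ * ((∑ e, q e) * Real.exp T)) := by
        rw [Finset.sum_mul, Finset.mul_sum, Finset.mul_sum]
    _ ≤ 2 / δ * T * (c⁻¹ * ((∑ e, q e) * Real.exp T)) := by gcongr
    _ = 2 / δ * (c⁻¹ * ∑ e, q e) * (T * Real.exp T) := by ring

theorem IsConformalVector.hasEntropy_one [NeZero k] (hl : ∀ i, 0 < l i) (hG : G.IsIrreducible)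
    (hq : G.IsConformalVector l q) (hpos : ∀ e, 0 < q e) : G.HasEntropy l 1 := by
  obtain ⟨c, hc, hlow⟩ := hq.exists_mul_exp_le_ncard_cyclesBelow hl hG hpos
  obtain ⟨C, hup⟩ := hq.exists_ncard_cyclesBelow_le hl hpos
  exact tendsto_one_div_mul_log_of_exp_le_of_le hc hlow hup

theorem HasEntropy.of_smul {s : ℝ} (hs : 0 < s) (h : G.HasEntropy (fun i => s * l i) 1) :
    G.HasEntropy l s := by
  have hscale := (h.comp (tendsto_id.const_mul_atTop hs)).const_mul s
  rw [mul_one] at hscale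
  refine hscale.congr fun T => ?_
  have hset : {γ : G.ClosedCycle | γ.length (fun i => s * l i) < s * T} =
      {γ : G.ClosedCycle | γ.length l < T} := by
    ext γ
    simp only [ClosedCycle.length, mem_ofPred_eq, ← Finset.mul_sum]
    exact mul_lt_mul_iff_right₀ hs
  simp only [Function.comp_apply, id_eq, hset]
  rw [← mul_assoc, mul_one_div, mul_comm s T, div_mul_cancel_right₀ hs.ne', one_div]

end Entropy

end FinGraph

namespace FigureEight

variable {l φ : Fin 2 → ℝ}

theorem adj_iff (e e' : DirEdge 2) : figureEight.Adj e e' ↔ e' ≠ e.bar := by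
  simp [FinGraph.Adj, FinGraph.origin, FinGraph.terminus, figureEight]

theorem adj_comm (e e' : DirEdge 2) : figureEight.Adj e e' ↔ figureEight.Adj e' e := by
  simp only [adj_iff]
  revert e e'
  decide

theorem isIrreducible : figureEight.IsIrreducible := by
  have htwo (e e' : DirEdge 2) : ∃ d, figureEight.Adj e d ∧ figureEight.Adj d e' := by
    simp only [adj_iff]
    revert e e'
    decide
  intro e e'
  obtain ⟨d, hed, hde'⟩ := htwo e e'
  exact (Relation.ReflTransGen.single hed).tail hde'

open Classical in
theorem sum_adj (g : Fin 2 → ℝ) (e : DirEdge 2) :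
    ∑ e' with figureEight.Adj e e', g e'.1 = 2 * (g 0 + g 1) - g e.1 := by
  have hfilter : ({e' | figureEight.Adj e e'} : Finset (DirEdge 2)) = Finset.univ.erase e.bar := by
    ext e'
    simp [adj_iff]
  rw [hfilter, Finset.sum_erase_eq_sub (Finset.mem_univ _), Fintype.sum_prod_type]
  simp only [Fintype.sum_bool, Fin.sum_univ_two, DirEdge.bar]
  ring

theorem transfer_onShift (l g : Fin 2 → ℝ) (x : figureEight.Shift) :
    figureEight.transfer (fun y => -figureEight.onShift l y) (figureEight.onShift g) x =
      2 * (Real.exp (-l 0) * g 0 + Real.exp (-l 1) * g 1) -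
        Real.exp (-l (x.1 0).1) * g (x.1 0).1 := by
  classical
  refine (FinGraph.transfer_edgeFun l (fun e => g e.1) x).trans ?_
  simp only [adj_comm _ (x.1 0)]
  exact sum_adj (fun i => Real.exp (-l i) * g i) (x.1 0)

section ConformalVector

/-- The equation in `e^{-l 0}` and `e^{-l 1}` which expresses that the transfer operator of `-l` has
a positive eigenvector with eigenvalue one. -/
def Critical (l : Fin 2 → ℝ) : Prop :=
  1 - Real.exp (-l 0) - Real.exp (-l 1) - 3 * Real.exp (-l 0) * Real.exp (-l 1) = 0

/-- The mass which the conformal measure of `-l` gives to the paths starting with `e`. -/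
def edgeMass (l : Fin 2 → ℝ) (e : DirEdge 2) : ℝ :=
  Real.exp (-l e.1) / (1 + Real.exp (-l e.1))

theorem edgeMass_pos (l : Fin 2 → ℝ) (e : DirEdge 2) : 0 < edgeMass l e := by
  unfold edgeMass
  positivity

theorem Critical.isConformalVector (h : Critical l) :
    figureEight.IsConformalVector l (edgeMass l) := by
  intro e
  have htotal : 2 * (Real.exp (-l 0) / (1 + Real.exp (-l 0)) +
      Real.exp (-l 1) / (1 + Real.exp (-l 1))) = 1 := by
    unfold Critical at h
    field_simp
    linarith
  refine Eq.trans ?_ (sum_adj (fun i => Real.exp (-l i) / (1 + Real.exp (-l i))) e).symm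
  rw [htotal, edgeMass, Real.exp_neg]
  field_simp
  ring

/-- The eigenfunction of the transfer operator of a critical `-l`. -/
def density (l : Fin 2 → ℝ) (i : Fin 2) : ℝ := (1 + Real.exp (-l i))⁻¹

theorem reversedDensity_edgeMass (l : Fin 2 → ℝ) :
    figureEight.reversedDensity l (edgeMass l) = figureEight.onShift (density l) := by
  funext x
  simp only [FinGraph.reversedDensity, edgeMass, FinGraph.onShift, density, DirEdge.bar,
    Real.exp_neg]
  field_simp

theorem existsUnique_isEquilibriumState (h : Critical l) :
    ∃! m, figureEight.IsEquilibriumState (fun x => -figureEight.onShift l x) m :=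
  h.isConformalVector.existsUnique_isEquilibriumState isIrreducible (edgeMass_pos l)

theorem isEquilibriumState_eqState (h : Critical l) :
    figureEight.IsEquilibriumState (fun x => -figureEight.onShift l x) (figureEight.eqState l) :=
  h.isConformalVector.isEquilibriumState_eqState isIrreducible (edgeMass_pos l)

end ConformalVector

section Entropy

theorem hasEntropy_one (hl : ∀ i, 0 < l i) (h : Critical l) : figureEight.HasEntropy l 1 :=
  h.isConformalVector.hasEntropy_one hl isIrreducible (edgeMass_pos l)

theorem exists_critical_smul (hl : ∀ i, 0 < l i) : ∃ s > 0, Critical (fun i => s * l i) := by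
  let F (s : ℝ) : ℝ := 1 - Real.exp (-(s * l 0)) - Real.exp (-(s * l 1)) -
    3 * Real.exp (-(s * l 0)) * Real.exp (-(s * l 1))
  have hcont : Continuous F := by fun_prop
  have hlim : Tendsto F atTop (𝓝 (1 - 0 - 0 - 3 * 0 * 0)) := by
    have h (i) : Tendsto (fun s : ℝ => Real.exp (-(s * l i))) atTop (𝓝 0) :=
      Real.tendsto_exp_neg_atTop_nhds_zero.comp (tendsto_id.atTop_mul_const (hl i))
    exact ((tendsto_const_nhds.sub (h 0)).sub (h 1)).sub (((h 0).const_mul 3).mul (h 1))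
  obtain ⟨s, hs, hFs⟩ : ∃ s > 0, 0 < F s :=
    ((eventually_gt_atTop 0).and (hlim.eventually (lt_mem_nhds (by norm_num)))).exists
  have hF₀ : F 0 < 0 := by norm_num [F]
  obtain ⟨t, ht, hFt⟩ := intermediate_value_Ioo hs.le hcont.continuousOn ⟨hF₀, hFs⟩
  exact ⟨t, ht.1, hFt⟩

-- Rescaling `l` to a critical weighting multiplies the entropy, so entropy one forces scale one.
theorem mem_entropyOne_iff : l ∈ figureEight.entropyOne ↔ (∀ i, 0 < l i) ∧ Critical l := by
  refine ⟨fun ⟨hl, hent⟩ => ⟨hl, ?_⟩, fun ⟨hl, h⟩ => ⟨hl, hasEntropy_one hl h⟩⟩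
  obtain ⟨s, hs, hcrit⟩ := exists_critical_smul hl
  have hent_s : figureEight.HasEntropy l s :=
    (hasEntropy_one (fun i => mul_pos hs (hl i)) hcrit).of_smul hs
  obtain rfl : s = 1 := tendsto_nhds_unique hent_s hent
  simpa only [one_mul] using hcrit

end Entropy

section Variance

/-- The second eigenvalue of the transfer operator of `-l` on edge functions. -/
def rate (l : Fin 2 → ℝ) : ℝ := Real.exp (-l 0) + Real.exp (-l 1) - 1

theorem exp_neg_lt_one {x : ℝ} (hx : 0 < x) : Real.exp (-x) < 1 :=
  Real.exp_lt_one_iff.2 (neg_lt_zero.2 hx)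

theorem abs_rate_lt_one (hl : ∀ i, 0 < l i) : |rate l| < 1 := by
  rw [abs_lt, rate]
  constructor <;> linarith [exp_neg_lt_one (hl 0), exp_neg_lt_one (hl 1), Real.exp_pos (-l 0),
    Real.exp_pos (-l 1)]

/-- The mean of an edge function with respect to the equilibrium state of `-l`. -/
def mean (l φ : Fin 2 → ℝ) : ℝ :=
  ((1 - Real.exp (-l 1)) * φ 0 + (1 - Real.exp (-l 0)) * φ 1) /
    (2 - Real.exp (-l 0) - Real.exp (-l 1))

theorem two_sub_exp_neg_sub_exp_neg_pos (hl : ∀ i, 0 < l i) :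
    0 < 2 - Real.exp (-l 0) - Real.exp (-l 1) := by
  linarith [exp_neg_lt_one (hl 0), exp_neg_lt_one (hl 1)]

theorem mean_eq_zero_iff (hl : ∀ i, 0 < l i) :
    mean l φ = 0 ↔ (1 - Real.exp (-l 1)) * φ 0 + (1 - Real.exp (-l 0)) * φ 1 = 0 := by
  rw [mean, div_eq_zero_iff, or_iff_left (two_sub_exp_neg_sub_exp_neg_pos hl).ne']

theorem mean_sub_mean (hl : ∀ i, 0 < l i) (φ : Fin 2 → ℝ) :
    mean l (fun i => φ i - mean l φ) = 0 := by
  have hne := (two_sub_exp_neg_sub_exp_neg_pos hl).ne'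
  rw [mean_eq_zero_iff hl, mean]
  field_simp
  ring

theorem mean_self_pos (hl : ∀ i, 0 < l i) : 0 < mean l l :=
  div_pos (add_pos (mul_pos (sub_pos.2 (exp_neg_lt_one (hl 1))) (hl 0))
    (mul_pos (sub_pos.2 (exp_neg_lt_one (hl 0))) (hl 1))) (two_sub_exp_neg_sub_exp_neg_pos hl)

theorem transfer_density_mul (hl : ∀ i, 0 < l i) (h : Critical l) (hφ : mean l φ = 0)
    (x : figureEight.Shift) :
    figureEight.transfer (fun x => -figureEight.onShift l x)
      (fun y => figureEight.onShift (density l) y * figureEight.onShift φ y) x =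
      rate l * (figureEight.onShift (density l) x * figureEight.onShift φ x) := by
  refine (transfer_onShift l (fun i => density l i * φ i) x).trans ?_
  rw [mean_eq_zero_iff hl] at hφ
  unfold Critical at h
  simp only [FinGraph.onShift, rate, density]
  generalize (x.1 0).1 = i
  fin_cases i
  · simp only [Fin.zero_eta]
    field_simp
    linear_combination (1 + Real.exp (-l 1)) * hφ - φ 1 * h
  · simp only [Fin.mk_one]
    field_simp
    linear_combination (1 + Real.exp (-l 0)) * hφ - φ 0 * h

theorem hasGeometricCorrelations (hl : ∀ i, 0 < l i) (h : Critical l) (hφ : mean l φ = 0) :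
    HasGeometricCorrelations figureEight.shift (figureEight.eqState l) (figureEight.onShift φ)
      (rate l) := by
  refine (isEquilibriumState_eqState h).hasGeometricCorrelations isIrreducible
    (FinGraph.continuous_reversedDensity l (edgeMass l))
    (FinGraph.reversedDensity_pos (edgeMass_pos l)) h.isConformalVector.transfer_reversedDensity
    (FinGraph.continuous_onShift φ) ?_
  rw [reversedDensity_edgeMass]
  exact transfer_density_mul hl h hφ

theorem integral_onShift (hl : ∀ i, 0 < l i) (h : Critical l) (φ : Fin 2 → ℝ) :
    ∫ x, figureEight.onShift φ x ∂(figureEight.eqState l) = mean l φ := by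
  have := (isEquilibriumState_eqState h).isProbabilityMeasure
  have hcentered : ∫ x, (figureEight.onShift φ x - mean l φ) ∂(figureEight.eqState l) = 0 :=
    (hasGeometricCorrelations hl h (mean_sub_mean hl φ)).integral_eq_zero
      (abs_lt.1 (abs_rate_lt_one hl)).2.ne
  rw [integral_sub (integrable_of_continuous (FinGraph.continuous_onShift φ))
    (integrable_const _), integral_const, probReal_univ, one_smul] at hcentered
  exact sub_eq_zero.1 hcentered

/-- The asymptotic variance of an edge function. -/
def variance (l φ : Fin 2 → ℝ) : ℝ :=
  (1 - Real.exp (-l 0)) * (1 - Real.exp (-l 1)) * (Real.exp (-l 0) + Real.exp (-l 1)) *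
    (φ 0 - φ 1) ^ 2 / (2 - Real.exp (-l 0) - Real.exp (-l 1)) ^ 3

theorem variance_eq (hl : ∀ i, 0 < l i) (φ : Fin 2 → ℝ) :
    (1 + rate l) / (1 - rate l) * mean l (fun i => (φ i - mean l φ) ^ 2) = variance l φ := by
  have hrate : 1 - rate l = 2 - Real.exp (-l 0) - Real.exp (-l 1) := by
    rw [rate]
    ring
  have hne := (two_sub_exp_neg_sub_exp_neg_pos hl).ne'
  rw [hrate]
  simp only [rate, mean, variance]
  field_simp
  ring

theorem tendsto_varSeq (hl : ∀ i, 0 < l i) (h : Critical l) (φ : Fin 2 → ℝ) :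
    Tendsto (figureEight.varSeq (figureEight.onShift φ) (figureEight.eqState l)) atTop
      (𝓝 (variance l φ)) := by
  have hm := isEquilibriumState_eqState h
  have := hm.isProbabilityMeasure
  let ψ : Fin 2 → ℝ := fun i => φ i - mean l φ
  have hψ : mean l ψ = 0 := mean_sub_mean hl φ
  have hlim := (hasGeometricCorrelations hl h hψ).tendsto_integral_birkhoffSum_sq
    FinGraph.continuous_shift (FinGraph.continuous_onShift ψ)
    (fun u hu => hm.integral_comp_shift hu) (abs_rate_lt_one hl)
  have hsq : ∫ x, figureEight.onShift ψ x ^ 2 ∂(figureEight.eqState l) = mean l fun i => ψ i ^ 2 :=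
    integral_onShift hl h fun i => ψ i ^ 2
  rw [hsq, variance_eq hl] at hlim
  refine hlim.congr fun n => ?_
  have hsum (x : figureEight.Shift) : birkhoffSum figureEight.shift (figureEight.onShift ψ) n x =
      birkhoffSum figureEight.shift (figureEight.onShift φ) n x - n * mean l φ := by
    simp only [birkhoffSum, FinGraph.onShift, ψ, Finset.sum_sub_distrib, Finset.sum_const,
      Finset.card_range, nsmul_eq_mul]
  simp only [FinGraph.varSeq, integral_onShift hl h, one_div, hsum]

theorem asympVar_eq (hl : ∀ i, 0 < l i) (h : Critical l) (φ : Fin 2 → ℝ) :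
    figureEight.asympVar (figureEight.onShift φ) (figureEight.eqState l) = variance l φ :=
  (tendsto_varSeq hl h φ).limUnder_eq

theorem wpNormSq_eq (hl : ∀ i, 0 < l i) (h : Critical l) (φ : Fin 2 → ℝ) :
    figureEight.wpNormSq l φ = variance l φ / mean l l := by
  rw [FinGraph.wpNormSq, asympVar_eq hl h, integral_onShift hl h]

end Variance

section Curve

variable {x : ℝ}

/-- The solution `Y = e^{-l 1}` of the equation `Critical l` for `l 0 = x`. -/
def curveExp (x : ℝ) : ℝ := (1 - Real.exp (-x)) / (1 + 3 * Real.exp (-x))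

theorem one_sub_exp_neg_pos (hx : 0 < x) : 0 < 1 - Real.exp (-x) :=
  sub_pos.2 (exp_neg_lt_one hx)

theorem curveExp_pos (hx : 0 < x) : 0 < curveExp x :=
  div_pos (one_sub_exp_neg_pos hx) (by positivity)

theorem one_sub_curveExp (x : ℝ) :
    1 - curveExp x = 4 * Real.exp (-x) / (1 + 3 * Real.exp (-x)) := by
  unfold curveExp
  field_simp
  ring

theorem one_sub_curveExp_pos (x : ℝ) : 0 < 1 - curveExp x := by
  rw [one_sub_curveExp]
  positivity

theorem neg_log_curveExp_pos (hx : 0 < x) : 0 < -Real.log (curveExp x) :=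
  neg_pos.2 (Real.log_neg (curveExp_pos hx) (sub_pos.1 (one_sub_curveExp_pos x)))

theorem continuous_curveExp : Continuous curveExp :=
  (by fun_prop : Continuous fun x : ℝ => 1 - Real.exp (-x)).div (by fun_prop)
    fun x => by positivity

theorem curve_zero (x : ℝ) : figureEightCurve x 0 = x := rfl

theorem curve_one (x : ℝ) : figureEightCurve x 1 = -Real.log (curveExp x) := rfl

theorem exp_neg_curve_one (hx : 0 < x) : Real.exp (-figureEightCurve x 1) = curveExp x := by
  rw [curve_one, neg_neg, Real.exp_log (curveExp_pos hx)]

theorem curve_pos (hx : 0 < x) (i : Fin 2) : 0 < figureEightCurve x i := by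
  fin_cases i
  exacts [hx, neg_log_curveExp_pos hx]

theorem critical_iff : Critical l ↔ Real.exp (-l 1) = curveExp (l 0) := by
  rw [Critical, curveExp, eq_div_iff (by positivity)]
  constructor <;> intro h <;> linarith

theorem critical_curve (hx : 0 < x) : Critical (figureEightCurve x) :=
  critical_iff.2 (exp_neg_curve_one hx)

theorem Critical.eq_curve (h : Critical l) : l = figureEightCurve (l 0) := by
  have hone : l 1 = figureEightCurve (l 0) 1 := by
    rw [curve_one, ← critical_iff.1 h, Real.log_exp, neg_neg]
  funext i
  fin_cases i
  exacts [rfl, hone]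

theorem entropyOne_eq : figureEight.entropyOne = figureEightCurve '' Ioi 0 := by
  ext l
  rw [mem_entropyOne_iff]
  constructor
  · rintro ⟨hl, h⟩
    exact ⟨l 0, hl 0, h.eq_curve.symm⟩
  · rintro ⟨x, hx, rfl⟩
    exact ⟨curve_pos hx, critical_curve hx⟩

theorem curve_mem_entropyOne (hx : 0 < x) : figureEightCurve x ∈ figureEight.entropyOne :=
  entropyOne_eq ▸ mem_image_of_mem _ hx

theorem eq_curve_of_mem_entropyOne (hl : l ∈ figureEight.entropyOne) :
    l = figureEightCurve (l 0) :=
  (mem_entropyOne_iff.1 hl).2.eq_curve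

/-- The derivative of the second coordinate of the curve. -/
def curveSlope (x : ℝ) : ℝ := -((1 - curveExp x) / (1 - Real.exp (-x)))

theorem hasDerivAt_neg_log_curveExp (hx : 0 < x) :
    HasDerivAt (fun x => -Real.log (curveExp x)) (curveSlope x) x := by
  have hexp : HasDerivAt (fun x : ℝ => Real.exp (-x)) (-Real.exp (-x)) x := by
    simpa using (hasDerivAt_neg x).exp
  have hcurveExp : HasDerivAt curveExp _ x :=
    (hexp.const_sub 1).div ((hexp.const_mul 3).const_add 1) (by positivity)
  refine (hcurveExp.log (curveExp_pos hx).ne').neg.congr_deriv ?_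
  have hne := (one_sub_exp_neg_pos hx).ne'
  rw [curveSlope, one_sub_curveExp, curveExp]
  field_simp
  ring

theorem hasDerivAt_curve (hx : 0 < x) : HasDerivAt figureEightCurve ![1, curveSlope x] x := by
  refine hasDerivAt_pi.2 fun i => ?_
  fin_cases i
  exacts [hasDerivAt_id x, hasDerivAt_neg_log_curveExp hx]

theorem contDiffOn_curve : ContDiffOn ℝ 1 figureEightCurve (Ioi 0) := by
  have hexp : ContDiff ℝ 1 fun x : ℝ => Real.exp (-x) := Real.contDiff_exp.comp contDiff_neg
  have hcurveExp : ContDiff ℝ 1 curveExp :=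
    (contDiff_const.sub hexp).div (contDiff_const.add (contDiff_const.mul hexp))
      fun x => by positivity
  refine contDiffOn_pi.2 fun i => ?_
  fin_cases i
  exacts [contDiffOn_id, (hcurveExp.contDiffOn.log fun x hx => (curveExp_pos hx).ne').neg]

theorem mem_tangentSpace_iff {φ : Fin 2 → ℝ} (hl : ∀ i, 0 < l i) (h : Critical l) :
    φ ∈ figureEight.tangentSpace l ↔ mean l φ = 0 := by
  rw [FinGraph.tangentSpace, mem_ofPred_eq, integral_onShift hl h]

theorem tangentSpace_curve (hx : 0 < x) :
    figureEight.tangentSpace (figureEightCurve x) =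
      range fun a : ℝ => a • deriv figureEightCurve x := by
  have hne := (one_sub_exp_neg_pos hx).ne'
  ext φ
  rw [mem_tangentSpace_iff (curve_pos hx) (critical_curve hx), mean_eq_zero_iff (curve_pos hx),
    exp_neg_curve_one hx, curve_zero, (hasDerivAt_curve hx).deriv]
  constructor
  · intro h
    have hone : φ 0 * curveSlope x = φ 1 := by
      rw [curveSlope]
      field_simp
      linarith
    refine ⟨φ 0, funext fun i => ?_⟩
    fin_cases i
    exacts [mul_one _, hone]
  · rintro ⟨a, rfl⟩
    change (1 - curveExp x) * (a * 1) + (1 - Real.exp (-x)) * (a * curveSlope x) = 0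
    rw [curveSlope]
    field_simp
    ring

end Curve

section Speed

variable {x : ℝ}

/-- The mean of the weighting `figureEightCurve x` up to the normalizing factor of `mean`. -/
def curveMean (x : ℝ) : ℝ :=
  (1 - curveExp x) * x + (1 - Real.exp (-x)) * -Real.log (curveExp x)

theorem curveMean_pos (hx : 0 < x) : 0 < curveMean x :=
  add_pos (mul_pos (one_sub_curveExp_pos x) hx)
    (mul_pos (one_sub_exp_neg_pos hx) (neg_log_curveExp_pos hx))

/-- The squared Weil-Petersson norm of the velocity of the curve. -/
def speedSq (x : ℝ) : ℝ :=
  (1 - curveExp x) * (Real.exp (-x) + curveExp x) / ((1 - Real.exp (-x)) * curveMean x)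

theorem speedSq_pos (hx : 0 < x) : 0 < speedSq x :=
  div_pos (mul_pos (one_sub_curveExp_pos x) (add_pos (Real.exp_pos _) (curveExp_pos hx)))
    (mul_pos (one_sub_exp_neg_pos hx) (curveMean_pos hx))

theorem wpNormSq_smul_velocity (hx : 0 < x) (a : ℝ) :
    figureEight.wpNormSq (figureEightCurve x) (a • ![1, curveSlope x]) = a ^ 2 * speedSq x := by
  have hX := (one_sub_exp_neg_pos hx).ne'
  have hmean := (curveMean_pos hx).ne'
  have hsum : 2 - Real.exp (-x) - curveExp x ≠ 0 := by
    linarith [one_sub_exp_neg_pos hx, one_sub_curveExp_pos x]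
  rw [wpNormSq_eq (curve_pos hx) (critical_curve hx), variance, mean, exp_neg_curve_one hx,
    curve_zero, curve_one, ← curveMean, speedSq]
  simp only [curveSlope, Pi.smul_apply, Matrix.cons_val_one, smul_eq_mul, Matrix.cons_val_zero,
    Matrix.cons_val_fin_one]
  field_simp
  ring

theorem wpNormSq_deriv_curve (hx : 0 < x) :
    figureEight.wpNormSq (figureEightCurve x) (deriv figureEightCurve x) = speedSq x := by
  simpa [(hasDerivAt_curve hx).deriv] using wpNormSq_smul_velocity hx 1

theorem continuousOn_speedSq : ContinuousOn speedSq (Ioi 0) := by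
  have hexp : ContinuousOn (fun x : ℝ => Real.exp (-x)) (Ioi 0) := by fun_prop
  have hcurveExp := continuous_curveExp.continuousOn (s := Ioi 0)
  have hlog := (hcurveExp.log fun x hx => (curveExp_pos hx).ne').neg
  have hmean : ContinuousOn curveMean (Ioi 0) :=
    ((continuousOn_const.sub hcurveExp).mul continuousOn_id).add
      ((continuousOn_const.sub hexp).mul hlog)
  exact ((continuousOn_const.sub hcurveExp).mul (hexp.add hcurveExp)).div
    ((continuousOn_const.sub hexp).mul hmean)
    fun x hx => (mul_pos (one_sub_exp_neg_pos hx) (curveMean_pos hx)).ne'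

end Speed

end FigureEight

section Comparable

variable {F : Filter ℝ} {f f' g : ℝ → ℝ}

theorem comparable_of_tendsto_div {a : ℝ} (ha : 0 < a)
    (h : Tendsto (fun x => f x / g x) F (𝓝 a)) : Comparable F f g :=
  ⟨a / 2, 2 * a, by positivity, by positivity,
    h.eventually (Ioo_mem_nhds (by linarith) (by linarith))⟩

theorem Comparable.congr_left (h : Comparable F f g) (hff' : f =ᶠ[F] f') : Comparable F f' g := by
  obtain ⟨c, c', hc, hc', hfg⟩ := h
  refine ⟨c, c', hc, hc', ?_⟩
  filter_upwards [hfg, hff'] with x hx heq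
  rwa [← heq]

theorem Comparable.exists_mul_sqrt_le_sqrt (h : Comparable F f g) (hg : ∀ᶠ x in F, 0 < g x) :
    ∃ c > 0, ∀ᶠ x in F, c * √(g x) ≤ √(f x) := by
  obtain ⟨c, _, hc, -, hfg⟩ := h
  refine ⟨√c, Real.sqrt_pos.2 hc, ?_⟩
  filter_upwards [hfg, hg] with x hx hgx
  rw [← Real.sqrt_mul hc.le]
  exact Real.sqrt_le_sqrt ((lt_div_iff₀ hgx).1 hx.1).le

end Comparable

namespace FigureEight

section Asymptotics

theorem neg_log_pos_of_mem_Ioo {x : ℝ} (hx : x ∈ Ioo (0 : ℝ) 1) : 0 < -Real.log x :=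
  neg_pos.2 (Real.log_neg hx.1 hx.2)

theorem tendsto_neg_log_nhdsGT_zero : Tendsto (fun x : ℝ => -Real.log x) (𝓝[>] 0) atTop :=
  tendsto_neg_atBot_atTop.comp Real.tendsto_log_nhdsGT_zero

theorem tendsto_exp_neg_nhdsGT_zero : Tendsto (fun x : ℝ => Real.exp (-x)) (𝓝[>] 0) (𝓝 1) := by
  have hcont : Continuous fun x : ℝ => Real.exp (-x) := by fun_prop
  simpa using (hcont.tendsto 0).mono_left nhdsWithin_le_nhds

theorem tendsto_one_sub_exp_neg_div_nhdsGT_zero :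
    Tendsto (fun x : ℝ => (1 - Real.exp (-x)) / x) (𝓝[>] 0) (𝓝 1) := by
  have hderiv : HasDerivAt (fun x : ℝ => 1 - Real.exp (-x)) 1 0 := by
    simpa using (hasDerivAt_neg (0 : ℝ)).exp.const_sub 1
  simpa [div_eq_inv_mul] using hderiv.tendsto_slope_zero_right

theorem tendsto_curveExp_nhdsGT_zero : Tendsto curveExp (𝓝[>] 0) (𝓝 0) := by
  simpa [curveExp] using (continuous_curveExp.tendsto 0).mono_left (nhdsWithin_le_nhds (s := Ioi 0))

theorem tendsto_log_curveExp_div_log_nhdsGT_zero :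
    Tendsto (fun x : ℝ => -Real.log (curveExp x) / -Real.log x) (𝓝[>] 0) (𝓝 1) := by
  have hnum := (tendsto_one_sub_exp_neg_div_nhdsGT_zero.log one_ne_zero).neg.add
    (((tendsto_exp_neg_nhdsGT_zero.const_mul 3).const_add 1).log (by norm_num))
  have hlim := (hnum.div_atTop tendsto_neg_log_nhdsGT_zero).const_add 1
  rw [add_zero] at hlim
  refine hlim.congr' ?_
  filter_upwards [Ioo_mem_nhdsGT one_pos] with x hx
  have hX := (one_sub_exp_neg_pos hx.1).ne'
  have hlog := (neg_log_pos_of_mem_Ioo hx).ne'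
  rw [curveExp, Real.log_div hX hx.1.ne', Real.log_div hX (by positivity), eq_div_iff hlog,
    add_mul, div_mul_cancel₀ _ hlog]
  ring

theorem tendsto_curveMean_div_nhdsGT_zero :
    Tendsto (fun x => curveMean x / (x * -Real.log x)) (𝓝[>] 0) (𝓝 1) := by
  have hlim := ((tendsto_curveExp_nhdsGT_zero.const_sub 1).div_atTop
    tendsto_neg_log_nhdsGT_zero).add
    (tendsto_one_sub_exp_neg_div_nhdsGT_zero.mul tendsto_log_curveExp_div_log_nhdsGT_zero)
  rw [zero_add, one_mul] at hlim
  refine hlim.congr' ?_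
  filter_upwards [self_mem_nhdsWithin] with x (hx : 0 < x)
  rw [curveMean, add_div, div_mul_div_comm, mul_comm x, mul_div_mul_right _ _ hx.ne']

theorem comparable_speedSq_nhdsGT_zero :
    Comparable (𝓝[>] 0) speedSq fun x => -1 / (x ^ 2 * Real.log x) := by
  refine comparable_of_tendsto_div (a := 1) one_pos ?_
  have hnum := (tendsto_curveExp_nhdsGT_zero.const_sub 1).mul
    (tendsto_exp_neg_nhdsGT_zero.add tendsto_curveExp_nhdsGT_zero)
  have hden := tendsto_one_sub_exp_neg_div_nhdsGT_zero.mul tendsto_curveMean_div_nhdsGT_zero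
  have hlim := hnum.div hden (by norm_num)
  rw [sub_zero, add_zero, one_mul, div_one] at hlim
  refine hlim.congr' ?_
  filter_upwards [Ioo_mem_nhdsGT one_pos] with x hx
  have hx₀ := hx.1.ne'
  have hX := (one_sub_exp_neg_pos hx.1).ne'
  have hmean := (curveMean_pos hx.1).ne'
  have hlog := (Real.log_neg hx.1 hx.2).ne
  rw [Pi.div_apply, speedSq]
  field_simp

theorem tendsto_curveExp_atTop : Tendsto curveExp atTop (𝓝 1) := by
  have hexp := Real.tendsto_exp_neg_atTop_nhds_zero
  have hlim : Tendsto curveExp atTop (𝓝 ((1 - 0) / (1 + 3 * 0))) :=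
    (hexp.const_sub 1).div ((hexp.const_mul 3).const_add 1) (by norm_num)
  simpa using hlim

theorem neg_log_div_one_sub_le_inv {y : ℝ} (hy : 0 < y) (hy₁ : y < 1) :
    -Real.log y / (1 - y) ≤ y⁻¹ := by
  rw [div_le_iff₀ (sub_pos.2 hy₁), mul_sub, mul_one, inv_mul_cancel₀ hy.ne']
  linarith [Real.one_sub_inv_le_log_of_pos hy]

theorem tendsto_curveMean_div_atTop :
    Tendsto (fun x => curveMean x / ((1 - curveExp x) * x)) atTop (𝓝 1) := by
  have hlog : Tendsto (fun x => -Real.log (curveExp x) / (1 - curveExp x) / x) atTop (𝓝 0) := by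
    refine squeeze_zero' ?_ ?_ ((tendsto_curveExp_atTop.inv₀ one_ne_zero).div_atTop tendsto_id)
    · filter_upwards [eventually_gt_atTop 0] with x hx
      exact div_nonneg
        (div_nonneg (neg_log_curveExp_pos hx).le (one_sub_curveExp_pos x).le) hx.le
    · filter_upwards [eventually_gt_atTop 0] with x hx
      exact div_le_div_of_nonneg_right (neg_log_div_one_sub_le_inv (curveExp_pos hx)
        (sub_pos.1 (one_sub_curveExp_pos x))) hx.le
  have hlim := ((Real.tendsto_exp_neg_atTop_nhds_zero.const_sub 1).mul hlog).const_add 1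
  rw [mul_zero, add_zero] at hlim
  refine hlim.congr' ?_
  filter_upwards [eventually_gt_atTop 0] with x hx
  have hY := (one_sub_curveExp_pos x).ne'
  rw [curveMean]
  field_simp

theorem comparable_speedSq_atTop : Comparable atTop speedSq fun x => 1 / x := by
  refine comparable_of_tendsto_div (a := 1) one_pos ?_
  have hexp := Real.tendsto_exp_neg_atTop_nhds_zero
  have hlim := (hexp.add tendsto_curveExp_atTop).div
    ((hexp.const_sub 1).mul tendsto_curveMean_div_atTop) (by norm_num)
  rw [zero_add, sub_zero, one_mul, div_one] at hlim
  refine hlim.congr' ?_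
  filter_upwards [eventually_gt_atTop 0] with x hx
  have hX := (one_sub_exp_neg_pos hx).ne'
  have hY := (one_sub_curveExp_pos x).ne'
  have hmean := (curveMean_pos hx).ne'
  rw [Pi.div_apply, speedSq]
  field_simp

theorem comparable_wpNormSq_nhdsGT_zero : Comparable (𝓝[>] 0)
    (fun x => figureEight.wpNormSq (figureEightCurve x) (deriv figureEightCurve x))
    (fun x => -1 / (x ^ 2 * Real.log x)) := by
  refine comparable_speedSq_nhdsGT_zero.congr_left ?_
  filter_upwards [self_mem_nhdsWithin] with x hx using (wpNormSq_deriv_curve hx).symm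

theorem comparable_wpNormSq_atTop : Comparable atTop
    (fun x => figureEight.wpNormSq (figureEightCurve x) (deriv figureEightCurve x))
    (fun x => 1 / x) := by
  refine comparable_speedSq_atTop.congr_left ?_
  filter_upwards [eventually_gt_atTop 0] with x hx using (wpNormSq_deriv_curve hx).symm

end Asymptotics

end FigureEight

section DerivComparison

variable {f f' g g' : ℝ → ℝ}

theorem monotoneOn_sub_of_hasDerivAt_le {s : Set ℝ} (hs : Convex ℝ s)
    (hf : ∀ x ∈ s, HasDerivAt f (f' x) x) (hg : ∀ x ∈ s, HasDerivAt g (g' x) x)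
    (hle : ∀ x ∈ s, g' x ≤ f' x) : MonotoneOn (fun x => f x - g x) s :=
  monotoneOn_of_hasDerivWithinAt_nonneg hs
    (fun x hx => ((hf x hx).sub (hg x hx)).continuousAt.continuousWithinAt)
    (fun x hx => ((hf x (interior_subset hx)).sub (hg x (interior_subset hx))).hasDerivWithinAt)
    (fun x hx => sub_nonneg.2 (hle x (interior_subset hx)))

theorem tendsto_atTop_of_hasDerivAt_le (hf : ∀ᶠ x in atTop, HasDerivAt f (f' x) x)
    (hg : ∀ᶠ x in atTop, HasDerivAt g (g' x) x) (hle : ∀ᶠ x in atTop, g' x ≤ f' x)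
    (hlim : Tendsto g atTop atTop) : Tendsto f atTop atTop := by
  obtain ⟨a, ha⟩ := eventually_atTop.1 (hf.and (hg.and hle))
  have hmono := monotoneOn_sub_of_hasDerivAt_le (convex_Ici a) (fun x hx => (ha x hx).1)
    (fun x hx => (ha x hx).2.1) (fun x hx => (ha x hx).2.2)
  refine tendsto_atTop_mono' _ ?_ (tendsto_atTop_add_const_left _ (f a - g a) hlim)
  filter_upwards [eventually_ge_atTop a] with x hx
  linarith [hmono self_mem_Ici hx hx]

theorem tendsto_nhdsGT_atBot_of_hasDerivAt_le {a : ℝ}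
    (hf : ∀ᶠ x in 𝓝[>] a, HasDerivAt f (f' x) x) (hg : ∀ᶠ x in 𝓝[>] a, HasDerivAt g (g' x) x)
    (hle : ∀ᶠ x in 𝓝[>] a, g' x ≤ f' x) (hlim : Tendsto g (𝓝[>] a) atBot) :
    Tendsto f (𝓝[>] a) atBot := by
  obtain ⟨b, hab, hb⟩ := mem_nhdsGT_iff_exists_Ioc_subset.1 (hf.and (hg.and hle))
  have hmono := monotoneOn_sub_of_hasDerivAt_le (convex_Ioc a b) (fun x hx => (hb hx).1)
    (fun x hx => (hb hx).2.1) (fun x hx => (hb hx).2.2)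
  refine tendsto_atBot_mono' _ ?_ (tendsto_atBot_add_const_left _ (f b - g b) hlim)
  filter_upwards [Ioc_mem_nhdsGT hab] with x hx
  linarith [hmono hx (right_mem_Ioc.2 hab) hx.2]

end DerivComparison

namespace FigureEight

section Arc

variable {x : ℝ}

/-- The Weil-Petersson norm of the velocity of the curve. -/
def speed (x : ℝ) : ℝ := √(speedSq x)

theorem speed_pos (hx : 0 < x) : 0 < speed x := Real.sqrt_pos.2 (speedSq_pos hx)

theorem continuousOn_speed : ContinuousOn speed (Ioi 0) := continuousOn_speedSq.sqrt

/-- The signed Weil-Petersson arc length of the curve, measured from the parameter `1`. -/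
def arc (x : ℝ) : ℝ := ∫ t in (1 : ℝ)..x, speed t

theorem hasDerivAt_arc (hx : 0 < x) : HasDerivAt arc (speed x) x := by
  have hsub : uIcc 1 x ⊆ Ioi 0 := fun t ht => (lt_min one_pos hx).trans_le ht.1
  exact intervalIntegral.integral_hasDerivAt_right
    (continuousOn_speed.mono hsub).intervalIntegrable
    (continuousOn_speed.stronglyMeasurableAtFilter isOpen_Ioi x hx)
    (continuousOn_speed.continuousAt (Ioi_mem_nhds hx))

theorem continuousOn_arc : ContinuousOn arc (Ioi 0) :=
  fun _ hx => (hasDerivAt_arc hx).continuousAt.continuousWithinAt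

theorem strictMonoOn_arc : StrictMonoOn arc (Ioi 0) := by
  refine strictMonoOn_of_deriv_pos (convex_Ioi 0) continuousOn_arc fun x hx => ?_
  rw [interior_Ioi] at hx
  rw [(hasDerivAt_arc hx).deriv]
  exact speed_pos hx

theorem tendsto_arc_atTop : Tendsto arc atTop atTop := by
  obtain ⟨c, hc, hle⟩ := comparable_speedSq_atTop.exists_mul_sqrt_le_sqrt
    ((eventually_gt_atTop 0).mono fun x hx => one_div_pos.2 hx)
  have hsqrt (x : ℝ) (hx : 0 < x) : HasDerivAt (fun x => 2 * c * √x) (c * √(1 / x)) x := by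
    refine ((Real.hasDerivAt_sqrt hx.ne').const_mul (2 * c)).congr_deriv ?_
    rw [Real.sqrt_div zero_le_one, Real.sqrt_one]
    field_simp
  exact tendsto_atTop_of_hasDerivAt_le ((eventually_gt_atTop 0).mono fun x hx => hasDerivAt_arc hx)
    ((eventually_gt_atTop 0).mono hsqrt) hle
    (Real.tendsto_sqrt_atTop.const_mul_atTop (by positivity))

theorem hasDerivAt_sqrt_neg_log (hx : x ∈ Ioo (0 : ℝ) 1) :
    HasDerivAt (fun x => √(-Real.log x)) (-(√(-1 / (x ^ 2 * Real.log x)) / 2)) x := by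
  have hlog := neg_log_pos_of_mem_Ioo hx
  have hderiv : HasDerivAt (fun x => √(-Real.log x)) (-x⁻¹ / (2 * √(-Real.log x))) x :=
    (Real.hasDerivAt_log hx.1.ne').neg.sqrt hlog.ne'
  refine hderiv.congr_deriv ?_
  have hsq : -1 / (x ^ 2 * Real.log x) = 1 / (x ^ 2 * -Real.log x) := by
    rw [mul_neg, div_neg, neg_div]
  rw [hsq, Real.sqrt_div zero_le_one, Real.sqrt_one, Real.sqrt_mul (sq_nonneg x),
    Real.sqrt_sq hx.1.le]
  ring

theorem tendsto_arc_nhdsGT_zero : Tendsto arc (𝓝[>] 0) atBot := by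
  have hpos : ∀ᶠ x : ℝ in 𝓝[>] 0, 0 < -1 / (x ^ 2 * Real.log x) := by
    filter_upwards [Ioo_mem_nhdsGT one_pos] with x hx
    exact div_pos_of_neg_of_neg neg_one_lt_zero
      (mul_neg_of_pos_of_neg (pow_pos hx.1 2) (Real.log_neg hx.1 hx.2))
  obtain ⟨c, hc, hle⟩ := comparable_speedSq_nhdsGT_zero.exists_mul_sqrt_le_sqrt hpos
  have hsqrt : ∀ᶠ x : ℝ in 𝓝[>] 0, HasDerivAt (fun x => -(2 * c) * √(-Real.log x))
      (c * √(-1 / (x ^ 2 * Real.log x))) x := by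
    filter_upwards [Ioo_mem_nhdsGT one_pos] with x hx
    exact ((hasDerivAt_sqrt_neg_log hx).const_mul (-(2 * c))).congr_deriv (by ring)
  exact tendsto_nhdsGT_atBot_of_hasDerivAt_le
    (eventually_mem_nhdsWithin.mono fun x hx => hasDerivAt_arc hx) hsqrt hle
    ((Real.tendsto_sqrt_atTop.comp tendsto_neg_log_nhdsGT_zero).const_mul_atTop_of_neg
      (neg_neg_of_pos (by positivity)))

theorem surjOn_arc : SurjOn arc (Ioi 0) univ := by
  intro y _
  obtain ⟨a, hay, ha : 0 < a⟩ := ((tendsto_arc_nhdsGT_zero.eventually_le_atBot y).and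
    self_mem_nhdsWithin).exists
  obtain ⟨b, hyb, hab⟩ := ((tendsto_arc_atTop.eventually_ge_atTop y).and
    (eventually_ge_atTop a)).exists
  have hsub : Icc a b ⊆ Ioi 0 := fun x hx => ha.trans_le hx.1
  exact ((intermediate_value_Icc hab (continuousOn_arc.mono hsub)).trans
    (image_mono hsub)) ⟨hay, hyb⟩

end Arc

section Length

theorem wpNorm_smul_velocity {x : ℝ} (hx : 0 < x) (a : ℝ) :
    figureEight.wpNorm (figureEightCurve x) (a • ![1, curveSlope x]) = |a| * speed x := by
  rw [FinGraph.wpNorm, wpNormSq_smul_velocity hx, Real.sqrt_mul (sq_nonneg a),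
    Real.sqrt_sq_eq_abs, speed]

variable {γ : ℝ → Fin 2 → ℝ} {l₁ l₂ : Fin 2 → ℝ} {t : ℝ}

theorem coord_pos (hγ : figureEight.IsCurve l₁ l₂ γ) (ht : t ∈ Icc (0 : ℝ) 1) : 0 < γ t 0 :=
  (hγ.2.1 t ht).1 0

theorem eq_curve_coord (hγ : figureEight.IsCurve l₁ l₂ γ) (ht : t ∈ Icc (0 : ℝ) 1) :
    γ t = figureEightCurve (γ t 0) :=
  eq_curve_of_mem_entropyOne (hγ.2.1 t ht)

theorem contDiffOn_coord (hγ : figureEight.IsCurve l₁ l₂ γ) :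
    ContDiffOn ℝ 1 (fun t => γ t 0) (Icc 0 1) :=
  contDiffOn_pi.1 hγ.1 0

theorem hasDerivWithinAt_coord (hγ : figureEight.IsCurve l₁ l₂ γ) (ht : t ∈ Icc (0 : ℝ) 1) :
    HasDerivWithinAt (fun t => γ t 0) (derivWithin (fun t => γ t 0) (Icc 0 1) t) (Icc 0 1) t :=
  ((contDiffOn_coord hγ).differentiableOn one_ne_zero t ht).hasDerivWithinAt

theorem wpNorm_derivWithin (hγ : figureEight.IsCurve l₁ l₂ γ) (ht : t ∈ Icc (0 : ℝ) 1) :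
    figureEight.wpNorm (γ t) (derivWithin γ (Icc 0 1) t) =
      |derivWithin (fun t => γ t 0) (Icc 0 1) t| * speed (γ t 0) := by
  have hpos := coord_pos hγ ht
  have hcomp := (hasDerivAt_curve hpos).scomp_hasDerivWithinAt t (hasDerivWithinAt_coord hγ ht)
  have hderiv := (hcomp.congr (fun s hs => eq_curve_coord hγ hs)
    (eq_curve_coord hγ ht)).derivWithin (uniqueDiffOn_Icc one_pos t ht)
  rw [hderiv, ← wpNorm_smul_velocity hpos, ← eq_curve_coord hγ ht]

theorem continuousOn_velocity (hγ : figureEight.IsCurve l₁ l₂ γ) : ContinuousOn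
    (fun t => derivWithin (fun t => γ t 0) (Icc 0 1) t * speed (γ t 0)) (Icc 0 1) :=
  ((contDiffOn_coord hγ).continuousOn_derivWithin (uniqueDiffOn_Icc one_pos) le_rfl).mul
    (continuousOn_speed.comp (contDiffOn_coord hγ).continuousOn fun _ ht => coord_pos hγ ht)

theorem wpLength_eq (hγ : figureEight.IsCurve l₁ l₂ γ) :
    figureEight.wpLength γ = ENNReal.ofReal (∫ t in (0 : ℝ)..1,
      |derivWithin (fun t => γ t 0) (Icc 0 1) t * speed (γ t 0)|) := by
  rw [intervalIntegral.integral_of_le zero_le_one, ← integral_Icc_eq_integral_Ioc,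
    ofReal_integral_eq_lintegral_ofReal (continuousOn_velocity hγ).abs.integrableOn_Icc
      (ae_of_all _ fun t => abs_nonneg _)]
  refine setLIntegral_congr_fun measurableSet_Icc fun t ht => ?_
  rw [wpNorm_derivWithin hγ ht, abs_mul, abs_of_pos (speed_pos (coord_pos hγ ht))]

theorem integral_velocity (hγ : figureEight.IsCurve l₁ l₂ γ) : ∫ t in (0 : ℝ)..1,
    derivWithin (fun t => γ t 0) (Icc 0 1) t * speed (γ t 0) = arc (l₂ 0) - arc (l₁ 0) := by
  have hderiv {t : ℝ} (ht : t ∈ Icc (0 : ℝ) 1) : HasDerivWithinAt (fun t => arc (γ t 0))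
      (derivWithin (fun t => γ t 0) (Icc 0 1) t * speed (γ t 0)) (Icc 0 1) t := by
    rw [mul_comm]
    exact (hasDerivAt_arc (coord_pos hγ ht)).comp_hasDerivWithinAt t (hasDerivWithinAt_coord hγ ht)
  rw [intervalIntegral.integral_eq_sub_of_hasDerivAt_of_le zero_le_one
    (f := fun t => arc (γ t 0)) (fun t ht => (hderiv ht).continuousWithinAt)
    (fun t ht => (hderiv (Ioo_subset_Icc_self ht)).hasDerivAt (Icc_mem_nhds ht.1 ht.2))
    ((continuousOn_velocity hγ).intervalIntegrable_of_Icc zero_le_one), hγ.2.2.1, hγ.2.2.2]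

theorem le_wpLength (hγ : figureEight.IsCurve l₁ l₂ γ) :
    ENNReal.ofReal |arc (l₂ 0) - arc (l₁ 0)| ≤ figureEight.wpLength γ := by
  rw [wpLength_eq hγ, ← integral_velocity hγ]
  exact ENNReal.ofReal_le_ofReal (intervalIntegral.abs_integral_le_integral_abs zero_le_one)

end Length

section Segment

variable {a b : ℝ}

/-- The curve from `figureEightCurve a` to `figureEightCurve b` along which the parameter moves
at constant speed. -/
def segmentCurve (a b t : ℝ) : Fin 2 → ℝ := figureEightCurve (AffineMap.lineMap a b t)

theorem lineMap_pos (ha : 0 < a) (hb : 0 < b) {t : ℝ} (ht : t ∈ Icc (0 : ℝ) 1) :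
    0 < AffineMap.lineMap a b t :=
  (convex_Ioi (0 : ℝ)).lineMap_mem ha hb ht

theorem isCurve_segmentCurve (ha : 0 < a) (hb : 0 < b) :
    figureEight.IsCurve (figureEightCurve a) (figureEightCurve b) (segmentCurve a b) := by
  refine ⟨?_, fun t ht => curve_mem_entropyOne (lineMap_pos ha hb ht), by simp [segmentCurve],
    by simp [segmentCurve]⟩
  have hline : ContDiff ℝ 1 fun t : ℝ => AffineMap.lineMap a b t :=
    (ContinuousAffineMap.lineMap (R := ℝ) a b).contDiff
  exact contDiffOn_curve.comp hline.contDiffOn fun t ht => lineMap_pos ha hb ht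

theorem wpLength_segmentCurve (ha : 0 < a) (hb : 0 < b) :
    figureEight.wpLength (segmentCurve a b) = ENNReal.ofReal |arc b - arc a| := by
  have hγ := isCurve_segmentCurve ha hb
  have hIcc : uIcc (0 : ℝ) 1 = Icc 0 1 := uIcc_of_le zero_le_one
  have hderiv {t : ℝ} (ht : t ∈ uIcc (0 : ℝ) 1) :
      derivWithin (fun t => segmentCurve a b t 0) (Icc 0 1) t = b - a := by
    rw [hIcc] at ht
    exact AffineMap.hasDerivWithinAt_lineMap.derivWithin (uniqueDiffOn_Icc one_pos t ht)
  have hspeed {t : ℝ} (ht : t ∈ Icc (0 : ℝ) 1) : 0 ≤ speed (segmentCurve a b t 0) :=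
    (speed_pos (coord_pos hγ ht)).le
  have hintegral : ∫ t in (0 : ℝ)..1, |derivWithin (fun t => segmentCurve a b t 0) (Icc 0 1) t *
      speed (segmentCurve a b t 0)| = |arc b - arc a| :=
    calc
      _ = ∫ t in (0 : ℝ)..1, |b - a| * speed (segmentCurve a b t 0) :=
        intervalIntegral.integral_congr fun t ht => by
          rw [hderiv ht, abs_mul, abs_of_nonneg (hspeed (hIcc ▸ ht))]
      _ = |∫ t in (0 : ℝ)..1, (b - a) * speed (segmentCurve a b t 0)| := by
        rw [intervalIntegral.integral_const_mul, intervalIntegral.integral_const_mul, abs_mul,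
          abs_of_nonneg (intervalIntegral.integral_nonneg zero_le_one fun t ht => hspeed ht)]
      _ = |∫ t in (0 : ℝ)..1, derivWithin (fun t => segmentCurve a b t 0) (Icc 0 1) t *
            speed (segmentCurve a b t 0)| := by
        congr 1
        exact intervalIntegral.integral_congr fun t ht => by rw [hderiv ht]
      _ = |arc b - arc a| := by rw [integral_velocity hγ, curve_zero, curve_zero]
  rw [wpLength_eq hγ, hintegral]

theorem wpDist_curve (ha : 0 < a) (hb : 0 < b) :
    figureEight.wpDist (figureEightCurve a) (figureEightCurve b) =
      ENNReal.ofReal |arc b - arc a| :=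
  le_antisymm
    ((iInf₂_le _ (isCurve_segmentCurve ha hb)).trans (wpLength_segmentCurve ha hb).le)
    (le_iInf₂ fun _ hγ => le_wpLength hγ)

end Segment

section Metric

/-- The arc length coordinate on the moduli space, an isometry onto `ℝ`. -/
def arcCoord (l : figureEight.EntropyOneSpace) : ℝ := arc (l.1 0)

theorem edist_arcCoord (l l' : figureEight.EntropyOneSpace) :
    edist (arcCoord l) (arcCoord l') = figureEight.wpDist l.1 l'.1 := by
  rw [eq_curve_of_mem_entropyOne l.2, eq_curve_of_mem_entropyOne l'.2,
    wpDist_curve (l.2.1 0) (l'.2.1 0), edist_dist, dist_comm, Real.dist_eq, arcCoord, arcCoord]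

theorem arcCoord_injective : Function.Injective arcCoord := fun l l' h => by
  apply Subtype.ext
  rw [eq_curve_of_mem_entropyOne l.2, eq_curve_of_mem_entropyOne l'.2,
    strictMonoOn_arc.injOn (l.2.1 0) (l'.2.1 0) h]

theorem arcCoord_surjective : Function.Surjective arcCoord := fun y => by
  obtain ⟨x, hx, rfl⟩ := surjOn_arc (mem_univ y)
  exact ⟨⟨figureEightCurve x, curve_mem_entropyOne hx⟩, rfl⟩

theorem exists_metricSpace_edist_eq_wpDist : ∃ M : MetricSpace figureEight.EntropyOneSpace,
    (∀ l l' : figureEight.EntropyOneSpace, M.edist l l' = figureEight.wpDist l.1 l'.1) ∧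
      @CompleteSpace figureEight.EntropyOneSpace M.toUniformSpace := by
  let M := MetricSpace.induced arcCoord arcCoord_injective inferInstance
  have hiso : Isometry arcCoord := fun _ _ => rfl
  exact ⟨M, edist_arcCoord,
    (hiso.isUniformInducing.completeSpace_congr arcCoord_surjective).2 inferInstance⟩

theorem tendsto_wpDist {F : Filter ℝ} {x₀ : ℝ} (hx₀ : 0 < x₀) (hF : ∀ᶠ x in F, 0 < x)
    (harc : Tendsto (fun x => |arc x - arc x₀|) F atTop) :
    Tendsto (fun x => figureEight.wpDist (figureEightCurve x₀) (figureEightCurve x)) F (𝓝 ⊤) := by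
  refine (ENNReal.tendsto_ofReal_atTop.comp harc).congr' ?_
  filter_upwards [hF] with x hx using (wpDist_curve hx₀ hx).symm

theorem tendsto_wpDist_nhdsGT_zero {x₀ : ℝ} (hx₀ : 0 < x₀) :
    Tendsto (fun x => figureEight.wpDist (figureEightCurve x₀) (figureEightCurve x))
      (𝓝[>] 0) (𝓝 ⊤) :=
  tendsto_wpDist hx₀ self_mem_nhdsWithin (tendsto_abs_atBot_atTop.comp
    (tendsto_atBot_add_const_right _ (-arc x₀) tendsto_arc_nhdsGT_zero))

theorem tendsto_wpDist_atTop {x₀ : ℝ} (hx₀ : 0 < x₀) :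
    Tendsto (fun x => figureEight.wpDist (figureEightCurve x₀) (figureEightCurve x))
      atTop (𝓝 ⊤) :=
  tendsto_wpDist hx₀ (eventually_gt_atTop 0) (tendsto_abs_atTop_atTop.comp
    (tendsto_atTop_add_const_right _ (-arc x₀) tendsto_arc_atTop))

end Metric

end FigureEight

end

theorem proposition4p2 :
    -- the moduli space is the curve `c(x)`, `x > 0`
    figureEight.entropyOne = figureEightCurve '' Set.Ioi 0 ∧
    -- the objects defining the metric are well defined
    (∀ l ∈ figureEight.entropyOne,
      (∃! m : MeasureTheory.Measure figureEight.Shift,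
        figureEight.IsEquilibriumState (fun x => -figureEight.onShift l x) m) ∧
      0 < ∫ x, figureEight.onShift l x ∂(figureEight.eqState l) ∧
      ∀ φ ∈ figureEight.tangentSpace l,
        Filter.Tendsto
          (figureEight.varSeq (figureEight.onShift φ) (figureEight.eqState l)) Filter.atTop
          (nhds (figureEight.asympVar (figureEight.onShift φ) (figureEight.eqState l)))) ∧
    -- the tangent line at `c(x)` is spanned by the velocity of the curve
    (∀ x : ℝ, 0 < x → DifferentiableAt ℝ figureEightCurve x ∧
      figureEight.tangentSpace (figureEightCurve x) =
        Set.range (fun a : ℝ => a • deriv figureEightCurve x)) ∧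
    -- the path distance is a metric, and it is complete
    (∃ M : MetricSpace figureEight.EntropyOneSpace,
      (∀ l l' : figureEight.EntropyOneSpace, M.edist l l' = figureEight.wpDist l.1 l'.1) ∧
      @CompleteSpace figureEight.EntropyOneSpace M.toUniformSpace) ∧
    -- the asymptotics of the norm at the two ends
    Comparable (nhdsWithin 0 (Set.Ioi 0))
      (fun x => figureEight.wpNormSq (figureEightCurve x) (deriv figureEightCurve x))
      (fun x => -1 / (x ^ 2 * Real.log x)) ∧
    Comparable Filter.atTop
      (fun x => figureEight.wpNormSq (figureEightCurve x) (deriv figureEightCurve x))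
      (fun x => 1 / x) ∧
    -- both ends lie at infinite distance
    (∀ x₀ : ℝ, 0 < x₀ →
      Filter.Tendsto
        (fun x => figureEight.wpDist (figureEightCurve x₀) (figureEightCurve x))
        (nhdsWithin 0 (Set.Ioi 0)) (nhds ⊤) ∧
      Filter.Tendsto
        (fun x => figureEight.wpDist (figureEightCurve x₀) (figureEightCurve x))
        Filter.atTop (nhds ⊤)) := by
  refine ⟨FigureEight.entropyOne_eq, fun l hl => ?_,
    fun x hx => ⟨(FigureEight.hasDerivAt_curve hx).differentiableAt,
      FigureEight.tangentSpace_curve hx⟩,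
    FigureEight.exists_metricSpace_edist_eq_wpDist, FigureEight.comparable_wpNormSq_nhdsGT_zero,
    FigureEight.comparable_wpNormSq_atTop, fun x₀ hx₀ =>
      ⟨FigureEight.tendsto_wpDist_nhdsGT_zero hx₀, FigureEight.tendsto_wpDist_atTop hx₀⟩⟩
  obtain ⟨hpos, hcrit⟩ := FigureEight.mem_entropyOne_iff.1 hl
  refine ⟨FigureEight.existsUnique_isEquilibriumState hcrit, ?_, fun φ _ => ?_⟩
  · rw [FigureEight.integral_onShift hpos hcrit]
    exact FigureEight.mean_self_pos hpos
  · rw [FigureEight.asympVar_eq hpos hcrit]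
    exact FigureEight.tendsto_varSeq hpos hcrit φ
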